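/- Let $R$ be a commutative ring and let $\mathrm{cAlg}_R$ be the category of commutative unital $R$-algebras, with the monoidal product $\otimes=\otimes_R$ (its coproduct) and unit $R$. A \emph{tangentoid} in a monoidal category $(\mathcal E,\otimes,I)$ (unitors and associators suppressed) is an object $D$ with morphisms $p\colon D\to I$, $z\colon I\to D$, $s\colon D_2\to D$, $l\colon D\to D\otimes D$, $c\colon D\otimes D\to D\otimes D$, where the $n$-fold pullbacks $D_n$ of $p$ along itself exist and are preserved by all iterates $D^k\otimes-$ of $D\otimes-$, such that: (1) $(p,z,s)$ is an additive bundle, i.e. a commutative monoid in the slice category over $I$; (2) $(z,l)\colon(D,p,z,s)\to(D\otimes D,\mathrm{id}\otimes p,\mathrm{id}\otimes z,\mathrm{id}\otimes s)$ and $(\mathrm{id},c)\colon(D\otimes D,p\otimes\mathrm{id},z\otimes\mathrm{id},s\otimes\mathrm{id})\to(D\otimes D,\mathrm{id}\otimes p,\mathrm{id}\otimes z,\mathrm{id}\otimes s)$ are additive bundle morphisms, i.e. they commute with projections, zero morphisms and sums; (3) $(\mathrm{id}\otimes l)l=(l\otimes\mathrm{id})l$, $cc=\mathrm{id}$, $(\mathrm{id}\otimes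 c)(c\otimes\mathrm{id})(\mathrm{id}\otimes c)=(c\otimes\mathrm{id})(\mathrm{id}\otimes c)(c\otimes\mathrm{id})$, $cl=l$ and $(c\otimes\mathrm{id})(\mathrm{id}\otimes c)(l\otimes\mathrm{id})=(\mathrm{id}\otimes l)c$; (4) the morphism $(\mathrm{id}\otimes s)\langle l\pi_1,(z\otimes\mathrm{id})\pi_2\rangle\colon D_2\to D\otimes D$ together with $p\pi_1\colon D_2\to I$ is a pullback of $\mathrm{id}\otimes p\colon D\otimes D\to D$ along $z\colon I\to D$. The tangentoid is \emph{coexponentiable} if each functor $D_n\otimes-\colon\mathcal E\to\mathcal E$ has a left adjoint. A morphism of tangentoids is a morphism of underlying objects compatible with $p,z,s,l,c$. A \emph{commutative solid non-unital $R$-algebra} is a commutative, associative, not necessarily unital $R$-algebra $M$ whose multiplication $M\otimes_R M\to M$ is an isomorphism. Let $R\ltimes M$ be the commutative unital $R$-algebra $R\oplus M$ with product $(a+m)(b+n)=ab+an+bm$. \textbf{Theorem.} (i) If $M$ is a commutative solid non-unital $R$-algebra whose underlying $R$-module is finitely generated and projective, then $R\ltimes M$ is a tangentoid in $\mathrm{cAlg}_R$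 with $p(a+m)=a$, $z(a)=a$, $s(a+m,a+n)=a+m+n$, $c(d\otimes e)=e\otimes d$, and $l$ the $R$-linear map with $l(a)=a\otimes 1$ for $a\in R$ and $l(xy)=x\otimes y$ for $x,y\in M$ (so that on $M$ it is the inverse of the multiplication). (ii) A tangentoid in $\mathrm{cAlg}_R$ is coexponentiable if and only if it is isomorphic, as a tangentoid, to the tangentoid $R\ltimes M$ of (i) for some commutative solid non-unital $R$-algebra $M$ whose underlying $R$-module is finitely generated and projective. -/

import Mathlib

open CategoryTheory MonoidalCategory Limits TensorProduct

universe v u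

noncomputable section

section Tangentoids

variable {C : Type u} [Category.{v} C] [MonoidalCategory C]

/-- The `k`-fold iterate of the endofunctor `D ⊗ -`. -/
def tensorIter (D : C) : ℕ → C ⥤ C
  | 0 => 𝟭 C
  | k + 1 => tensorIter D k ⋙ tensorLeft D

/-- A morphism `p : D ⟶ 𝟙_ C` all of whose `n`-fold pullbacks along itself exist and are preserved
by all iterates of the endofunctor `D ⊗ -`. -/
structure TangentoidProj (D : C) where
  p : D ⟶ 𝟙_ C
  hasPullback : ∀ n : ℕ, HasWidePullback (𝟙_ C) (fun _ : Fin n => D) (fun _ => p)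
  preserves : ∀ k n : ℕ, PreservesLimit
    (WidePullbackShape.wideCospan (𝟙_ C) (fun _ : Fin n => D) (fun _ => p)) (tensorIter D k)

namespace TangentoidProj

variable {D : C} (P : TangentoidProj D)

/-- The `n`-fold pullback `D_n` of `p` along itself. -/
def pow (n : ℕ) : C :=
  haveI := P.hasPullback n
  widePullback (𝟙_ C) (fun _ : Fin n => D) (fun _ => P.p)

/-- The projections `π_i : D_n ⟶ D`, indexed from `0`. -/
def π {n : ℕ} (i : Fin n) : P.pow n ⟶ D :=
  haveI := P.hasPullback n
  WidePullback.π (fun _ : Fin n => P.p) i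

lemma π_p {n : ℕ} (i j : Fin n) : P.π i ≫ P.p = P.π j ≫ P.p := by
  have := P.hasPullback n
  exact (WidePullback.π_arrow (fun _ : Fin n => P.p) i).trans
    (WidePullback.π_arrow (fun _ : Fin n => P.p) j).symm

/-- The pairing `⟨f, g⟩ : X ⟶ D_2`. -/
def pair {X : C} (f g : X ⟶ D) (h : f ≫ P.p = g ≫ P.p) : X ⟶ P.pow 2 :=
  haveI := P.hasPullback 2
  WidePullback.lift (f ≫ P.p) ![f, g] (by intro j; fin_cases j <;> simp [h])

lemma pair_π_zero {X : C} (f g : X ⟶ D) (h : f ≫ P.p = g ≫ P.p) :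
    P.pair f g h ≫ P.π 0 = f := by
  have := P.hasPullback 2
  exact WidePullback.lift_π (fun _ : Fin 2 => P.p) _ _ _ 0

lemma pair_π_one {X : C} (f g : X ⟶ D) (h : f ≫ P.p = g ≫ P.p) :
    P.pair f g h ≫ P.π 1 = g := by
  have := P.hasPullback 2
  exact WidePullback.lift_π (fun _ : Fin 2 => P.p) _ _ _ 1

/-- The pairing `⟨f, g⟩ : X ⟶ D ⊗ D_2`, where `D ⊗ D_2` is the pullback of `D ◁ p` along itself
because `D ⊗ -` preserves the pullback `D_2`. -/
def tensorPair {X : C} (f g : X ⟶ D ⊗ D) (h : f ≫ D ◁ P.p = g ≫ D ◁ P.p) :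
    X ⟶ D ⊗ P.pow 2 :=
  haveI := P.hasPullback 2
  haveI := P.preserves 1 2
  (isLimitOfPreserves (tensorIter D 1) (limit.isLimit (WidePullbackShape.wideCospan (𝟙_ C)
    (fun _ : Fin 2 => D) (fun _ => P.p)))).lift
    (WidePullbackShape.mkCone
      (F := WidePullbackShape.wideCospan (𝟙_ C) (fun _ : Fin 2 => D) (fun _ => P.p) ⋙
        tensorIter D 1)
      (f ≫ D ◁ P.p) ![f, g] (by
        intro j
        fin_cases j
        · rfl
        · exact h.symm))

lemma tensorPair_π_zero {X : C} (f g : X ⟶ D ⊗ D) (h : f ≫ D ◁ P.p = g ≫ D ◁ P.p) :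
    P.tensorPair f g h ≫ D ◁ P.π 0 = f := by
  have := P.hasPullback 2
  have := P.preserves 1 2
  exact (isLimitOfPreserves (tensorIter D 1) (limit.isLimit (WidePullbackShape.wideCospan (𝟙_ C)
    (fun _ : Fin 2 => D) (fun _ => P.p)))).fac _ (some 0)

lemma tensorPair_π_one {X : C} (f g : X ⟶ D ⊗ D) (h : f ≫ D ◁ P.p = g ≫ D ◁ P.p) :
    P.tensorPair f g h ≫ D ◁ P.π 1 = g := by
  have := P.hasPullback 2
  have := P.preserves 1 2
  exact (isLimitOfPreserves (tensorIter D 1) (limit.isLimit (WidePullbackShape.wideCospan (𝟙_ C)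
    (fun _ : Fin 2 => D) (fun _ => P.p)))).fac _ (some 1)

end TangentoidProj

/-- A tangentoid structure on an object `D` of a monoidal category. -/
structure Tangentoid (D : C) where
  P : TangentoidProj D
  z : 𝟙_ C ⟶ D
  s : P.pow 2 ⟶ D
  l : D ⟶ D ⊗ D
  c : D ⊗ D ⟶ D ⊗ D
  -- `(p, z, s)` is an additive bundle
  z_p : z ≫ P.p = 𝟙 (𝟙_ C)
  s_p : s ≫ P.p = P.π 0 ≫ P.p
  s_comm : P.pair (P.π 1) (P.π 0) (P.π_p 1 0) ≫ s = s
  s_assoc :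
    P.pair (P.pair (P.π (n := 3) 0) (P.π 1) (P.π_p 0 1) ≫ s) (P.π 2)
      (by rw [Category.assoc, s_p, ← Category.assoc, TangentoidProj.pair_π_zero, P.π_p 0 2]) ≫ s =
    P.pair (P.π (n := 3) 0) (P.pair (P.π 1) (P.π 2) (P.π_p 1 2) ≫ s)
      (by rw [Category.assoc, s_p, ← Category.assoc, TangentoidProj.pair_π_zero, P.π_p 0 1]) ≫ s
  z_s : P.pair (P.p ≫ z) (𝟙 D) (by simp [z_p]) ≫ s = 𝟙 D
  -- `(z, l)` is an additive bundle morphism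
  l_p : l ≫ D ◁ P.p ≫ (ρ_ D).hom = P.p ≫ z
  z_l : z ≫ l = z ≫ (ρ_ D).inv ≫ D ◁ z
  s_l : P.tensorPair (P.π 0 ≫ l) (P.π 1 ≫ l)
      (by rw [← cancel_mono (ρ_ D).hom]
          simp only [Category.assoc, l_p]
          rw [← Category.assoc, P.π_p (n := 2) 0 1, Category.assoc]) ≫ D ◁ s = s ≫ l
  -- `(id, c)` is an additive bundle morphism
  c_p : c ≫ D ◁ P.p ≫ (ρ_ D).hom = P.p ▷ D ≫ (λ_ D).hom
  z_c : (λ_ D).inv ≫ z ▷ D ≫ c = (ρ_ D).inv ≫ D ◁ z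
  s_c : P.tensorPair (P.π 0 ▷ D ≫ c) (P.π 1 ▷ D ≫ c)
      (by rw [← cancel_mono (ρ_ D).hom]
          simp only [Category.assoc, c_p]
          rw [← comp_whiskerRight_assoc, P.π_p (n := 2) 0 1, comp_whiskerRight_assoc]) ≫ D ◁ s = s ▷ D ≫ c
  -- coassociativity of `l`, involutivity of `c` and the Yang-Baxter equation for `c`
  l_l : l ≫ D ◁ l = l ≫ l ▷ D ≫ (α_ D D D).hom
  c_c : c ≫ c = 𝟙 (D ⊗ D)
  c_yang_baxter :
    D ◁ c ≫ ((α_ D D D).inv ≫ c ▷ D ≫ (α_ D D D).hom) ≫ D ◁ c =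
      ((α_ D D D).inv ≫ c ▷ D ≫ (α_ D D D).hom) ≫ D ◁ c ≫
        ((α_ D D D).inv ≫ c ▷ D ≫ (α_ D D D).hom)
  -- compatibility of `l` and `c`
  l_c : l ≫ c = l
  c_l : l ▷ D ≫ (α_ D D D).hom ≫ D ◁ c ≫ (α_ D D D).inv ≫ c ▷ D ≫ (α_ D D D).hom = c ≫ D ◁ l
  -- the vertical lift is universal
  universal : IsPullback
    (P.tensorPair (P.π 0 ≫ l) (P.π 1 ≫ (λ_ D).inv ≫ z ▷ D)
      (by have h : (λ_ D).inv ≫ z ▷ D ≫ D ◁ P.p ≫ (ρ_ D).hom = P.p ≫ z := by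
            rw [← whisker_exchange_assoc, ← leftUnitor_inv_naturality_assoc,
              rightUnitor_naturality, ← unitors_equal, Iso.inv_hom_id_assoc]
          rw [← cancel_mono (ρ_ D).hom]
          simp only [Category.assoc, l_p, h]
          rw [← Category.assoc, P.π_p (n := 2) 0 1, Category.assoc]) ≫ D ◁ s)
    (P.π 0 ≫ P.p) (D ◁ P.p ≫ (ρ_ D).hom) z

namespace Tangentoid

variable {D D' : C}

/-- A tangentoid is coexponentiable when each functor `D_n ⊗ -` has a left adjoint. -/
def Coexponentiable (T : Tangentoid D) : Prop :=
  ∀ n : ℕ, (tensorLeft (T.P.pow n)).IsRightAdjoint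

/-- The morphisms of tangentoids. -/
structure IsHom (T : Tangentoid D) (T' : Tangentoid D') (f : D ⟶ D') : Prop where
  comp_p : f ≫ T'.P.p = T.P.p
  z_comp : T.z ≫ f = T'.z
  comp_s : T'.P.pair (T.P.π 0 ≫ f) (T.P.π 1 ≫ f)
    (by simp only [Category.assoc, comp_p]; exact T.P.π_p 0 1) ≫ T'.s = T.s ≫ f
  comp_l : f ≫ T'.l = T.l ≫ (f ⊗ₘ f)
  comp_c : (f ⊗ₘ f) ≫ T'.c = T.c ≫ (f ⊗ₘ f)

/-- An isomorphism of tangentoids: a morphism of tangentoids whose underlying morphism is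
invertible (the inverse is then a morphism of tangentoids as well). -/
def Isomorphic (T : Tangentoid D) (T' : Tangentoid D') : Prop :=
  ∃ e : D ≅ D', T.IsHom T' e.hom

end Tangentoid

end Tangentoids

section Algebras

/-- Commutative solid non-unital `R`-algebras: commutative, associative, not necessarily unital
`R`-algebras `M` whose multiplication `M ⊗ M → M` is an isomorphism. -/
structure CommSolidAlg (R : Type u) [CommRing R] where
  carrier : Type u
  [nonUnitalCommRing : NonUnitalCommRing carrier]
  [module : Module R carrier]
  [isScalarTower : IsScalarTower R carrier carrier]
  [smulCommClass : SMulCommClass R carrier carrier]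
  bijective_mul : Function.Bijective (LinearMap.mul' R carrier)

namespace CommSolidAlg

variable {R : Type u} [CommRing R]

instance : CoeSort (CommSolidAlg R) (Type u) := ⟨carrier⟩

attribute [instance] nonUnitalCommRing module isScalarTower smulCommClass

/-- The right `R`-module structure agreeing with the left one, as `TrivSqZeroExt` asks for it. -/
instance (M : CommSolidAlg R) : Module Rᵐᵒᵖ M :=
  Module.compHom M ((RingHom.id R).fromOpposite fun _ _ => mul_comm _ _)

instance (M : CommSolidAlg R) : IsCentralScalar R M := ⟨fun _ _ => rfl⟩

/-- The algebra `R ⋉ M`: the module `R ⊕ M` with `(a + m) (b + n) = a b + a n + b m`. -/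
abbrev semidirect (M : CommSolidAlg R) : CommAlgCat.{u} R :=
  CommAlgCat.of R (TrivSqZeroExt R M)

/-- The tangentoid structure `T` on `R ⋉ M` is the one associated with `M`. Here `l` is given by the
inverse `M → M ⊗ M` of the multiplication, that is, it sends `x y` to `x ⊗ y` for `x, y` in `M`. -/
structure IsAssociated (M : CommSolidAlg R) (T : Tangentoid M.semidirect) : Prop where
  p_apply : ∀ d : TrivSqZeroExt R M, T.P.p.hom d = d.fst
  z_apply : ∀ a : R, T.z.hom a = (TrivSqZeroExt.inl a : TrivSqZeroExt R M)
  s_apply : ∀ w : T.P.pow 2, T.s.hom w =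
    (TrivSqZeroExt.inl (TrivSqZeroExt.fst ((T.P.π 0).hom w)) +
      TrivSqZeroExt.inr (TrivSqZeroExt.snd ((T.P.π 0).hom w) + TrivSqZeroExt.snd ((T.P.π 1).hom w)) :
      TrivSqZeroExt R M)
  l_inl : ∀ a : R, T.l.hom (TrivSqZeroExt.inl a : TrivSqZeroExt R M) =
    (TrivSqZeroExt.inl a : TrivSqZeroExt R M) ⊗ₜ[R] (1 : TrivSqZeroExt R M)
  l_inr : ∀ x y : M, T.l.hom (TrivSqZeroExt.inr (x * y) : TrivSqZeroExt R M) =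
    (TrivSqZeroExt.inr x : TrivSqZeroExt R M) ⊗ₜ[R] (TrivSqZeroExt.inr y : TrivSqZeroExt R M)
  c_apply : ∀ d e : TrivSqZeroExt R M, T.c.hom (d ⊗ₜ[R] e) = e ⊗ₜ[R] d

end CommSolidAlg

end Algebras

end

/-! A tangentoid `D` of commutative algebras has little freedom. The unit `R` is initial, so `z` is
the structure map and `D = R ⊕ K` with `K = ker p`. As `s` is a ring homomorphism, unitality and
commutativity force `s(d, e) = d + e - r` over the common augmentation `r`
(`tangentoid_isFiberAdd`); applying `s` to `(d, 0) * (0, e) = 0` gives `K² = 0`, so `D ≅ R ⋉ K`. The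
condition on `c` and `z`, with `cc = id`, makes `c` the swap. Finally `l` maps `K` into `K ⊗ K`, and
universality of the lift makes `K → K ⊗ K` bijective (`augComul_bijective`); its inverse is a
multiplication, commutative by `cl = l` and associative by coassociativity, so `K` is solid.
Conversely, reading this backwards from a solid `M` verifies every axiom (`mkTangentoid`).

For coexponentiability, `B ⊗ -` on commutative algebras is a right adjoint exactly when `B` is
finitely generated projective (`isRightAdjoint_tensorLeft_iff`). Preservation of the powers of `R`
and of monomorphisms makes `B` finitely presented and flat; conversely a dual basis gives
preservation of limits and a solution set. Since `D_n ≅ R ⊕ Kⁿ` as modules, the condition for all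
`n` is a condition on `K` alone. -/

noncomputable section

/-! ### Limits, pullbacks and monomorphisms of commutative algebras in terms of elements. -/

namespace CommAlgCat

universe w w'

variable {R : Type u} [CommRing R]

instance forget_preservesLimits : PreservesLimits (forget (CommAlgCat.{u} R)) :=
  inferInstanceAs (PreservesLimits ((commAlgCatEquivUnder (.of R)).functor ⋙ Under.forget _ ⋙
    forget CommRingCat.{u}))

instance forget_preservesLimitsOfSize_zero :
    PreservesLimitsOfSize.{0, 0} (forget (CommAlgCat.{u} R)) :=
  preservesSmallestLimits_of_preservesLimits _

/-- A cone of commutative algebras is a limit cone when its elements are the compatible families. -/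
lemma nonempty_isLimit_iff {J : Type w} [Category.{w'} J] {F : J ⥤ CommAlgCat.{u} R} [HasLimit F]
    [PreservesLimit F (forget (CommAlgCat.{u} R))] (c : Cone F) :
    Nonempty (IsLimit c) ↔ ∀ x : ∀ j, F.obj j, (∀ (i j : J) (f : i ⟶ j), (F.map f).hom (x i) =
        x j) →
      ∃! y : c.pt, ∀ j, (c.π.app j).hom y = x j := by
  have := reflectsLimit_of_reflectsIsomorphisms F (forget (CommAlgCat.{u} R))
  have h : Nonempty (IsLimit c) ↔ Nonempty (IsLimit ((forget (CommAlgCat.{u} R)).mapCone c)) :=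
    ⟨fun ⟨h⟩ => ⟨isLimitOfPreserves _ h⟩, fun ⟨h⟩ => ⟨isLimitOfReflects _ h⟩⟩
  rw [h, Types.isLimit_iff]
  constructor
  · intro H x hx
    exact H x (fun f => hx _ _ f)
  · intro H s hs
    exact H s (fun i j f => hs f)

lemma isPullback_iff {P X Y Z : CommAlgCat.{u} R} (f : P ⟶ X) (g : P ⟶ Y) (h : X ⟶ Z) (k : Y ⟶ Z) :
    IsPullback f g h k ↔ f ≫ h = g ≫ k ∧
      (∀ w w' : P, f.hom w = f.hom w' → g.hom w = g.hom w' → w = w') ∧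
      ∀ x y, h.hom x = k.hom y → ∃ w, f.hom w = x ∧ g.hom w = y := by
  constructor
  · intro H
    have := (Types.isPullback_iff _ _ _ _).1 (H.map (forget (CommAlgCat.{u} R)))
    exact ⟨H.w, fun w w' h1 h2 => this.2.1 w w' ⟨h1, h2⟩, this.2.2⟩
  · rintro ⟨h1, h2, h3⟩
    refine IsPullback.of_map (forget (CommAlgCat.{u} R)) h1 ?_
    refine (Types.isPullback_iff _ _ _ _).2 ⟨?_, fun w w' h => h2 w w' h.1 h.2, h3⟩
    rw [← Functor.map_comp, h1, Functor.map_comp]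

lemma injective_of_mono {X Y : CommAlgCat.{u} R} (f : X ⟶ Y) [Mono f] :
    Function.Injective f.hom :=
  (mono_iff_injective _).1 ((forget (CommAlgCat.{u} R)).map_mono f)

lemma mono_of_injective {X Y : CommAlgCat.{u} R} (f : X ⟶ Y) (h : Function.Injective f.hom) :
    Mono f :=
  (forget (CommAlgCat.{u} R)).mono_of_mono_map ((mono_iff_injective _).2 h)

end CommAlgCat

/-! ### Fibre powers of trivial square-zero extensions and their preservation by tensoring. -/

namespace CommAlgCat

variable {R : Type u} [CommRing R] {M : Type u} [AddCommGroup M] [Module R M] [Module Rᵐᵒᵖ M]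
  [IsCentralScalar R M]

variable (R M) in
/-- The augmentation of a trivial square-zero extension. -/
def tszFst : CommAlgCat.of R (TrivSqZeroExt R M) ⟶ 𝟙_ (CommAlgCat.{u} R) :=
  ofHom (TrivSqZeroExt.fstHom R R M)

variable (R M) in
/-- The cospan formed by `n` copies of the augmentation of a trivial square-zero extension. -/
abbrev tszCospan (n : ℕ) : WidePullbackShape (Fin n) ⥤ CommAlgCat.{u} R :=
  WidePullbackShape.wideCospan (𝟙_ (CommAlgCat.{u} R)) (fun _ : Fin n => CommAlgCat.of R
      (TrivSqZeroExt R M))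
    (fun _ => tszFst R M)

variable (R M) in
/-- The trivial square-zero extension by `Fin n → M` as a cone over `tszCospan R M n`. -/
def tszCone (n : ℕ) : Cone (tszCospan R M n) :=
  WidePullbackShape.mkCone (F := tszCospan R M n) (tszFst R (Fin n → M))
    (fun i => ofHom (TrivSqZeroExt.map (LinearMap.proj i))) (by
      intro j
      exact hom_ext (TrivSqZeroExt.fstHom_comp_map _))

open TrivSqZeroExt in
-- The cone is split: the linear maps `σ` and `τ i` reassemble an element from its base and its
-- `M`-components. The identities expressing this are linear, so they survive `A ⊗ -` without any
-- flatness of `A`.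
lemma lTensor_tszCone_isLimit (A : CommAlgCat.{u} R) (n : ℕ) :
    Nonempty (IsLimit ((tensorLeft A).mapCone (tszCone R M n))) := by
  rw [nonempty_isLimit_iff]
  intro x hx
  let x₀ : A ⊗[R] R := x none
  let x₁ (i : Fin n) : A ⊗[R] (TrivSqZeroExt R M) := x (some i)
  let σ : R →ₗ[R] TrivSqZeroExt R (Fin n → M) := (inlAlgHom R R (Fin n → M)).toLinearMap
  let τ (i : Fin n) : TrivSqZeroExt R M →ₗ[R] TrivSqZeroExt R (Fin n → M) :=
    inrHom R (Fin n → M) ∘ₗ LinearMap.single R (fun _ => M) i ∘ₗ sndHom R M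
  have hx' (i : Fin n) : (fstHom R R M).toLinearMap.lTensor A (x₁ i) = x₀ :=
    hx _ _ (WidePullbackShape.Hom.term i)
  let π (i : Fin n) : TrivSqZeroExt R (Fin n → M) →ₗ[R] TrivSqZeroExt R M :=
    (TrivSqZeroExt.map (LinearMap.proj i)).toLinearMap
  let β (N : Type u) [AddCommGroup N] [Module R N] [Module Rᵐᵒᵖ N] [IsCentralScalar R N] :
    TrivSqZeroExt R N →ₗ[R] R := (fstHom R R N).toLinearMap
  have hβσ : β _ ∘ₗ σ = LinearMap.id := by ext; simp [β, σ]
  have hβτ (i) : β _ ∘ₗ τ i = 0 := by ext; simp [β, τ]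
  have hπσ (i) : π i ∘ₗ σ = (inlAlgHom R R M).toLinearMap := by
    ext <;> simp [π, σ]
  have hπτ (i j) : π i ∘ₗ τ j = if i = j then inrHom R M ∘ₗ sndHom R M else 0 := by
    split_ifs with h
    · subst h; ext <;> simp [π, τ]
    · ext <;> simp [π, τ, h]
  have hD : (inlAlgHom R R M).toLinearMap ∘ₗ β M + inrHom R M ∘ₗ sndHom R M = LinearMap.id := by
    ext <;> simp [β]
  have hS : σ ∘ₗ β _ + ∑ i, τ i ∘ₗ π i = LinearMap.id := by
    refine LinearMap.ext fun x => ?_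
    ext i
    · simp [β, σ, π, τ, ← inr_sum]
    · simp [β, σ, π, τ, ← inr_sum, Finset.sum_apply, Pi.single_apply]
  have hcomp {N₁ N₂ N₃ : Type u} [AddCommGroup N₁] [AddCommGroup N₂] [AddCommGroup N₃] [Module R N₁]
      [Module R N₂] [Module R N₃] (g : N₂ →ₗ[R] N₃) (f : N₁ →ₗ[R] N₂) (y : A ⊗[R] N₁) :
      g.lTensor A (f.lTensor A y) = (g ∘ₗ f).lTensor A y :=
          (LinearMap.lTensor_comp_apply A g f y).symm
  refine ⟨σ.lTensor A x₀ + ∑ i, (τ i).lTensor A (x₁ i), ?_, ?_⟩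
  · rintro (_ | i)
    · change (β _).lTensor A _ = x₀
      simp only [map_add, map_sum, hcomp, hβσ, hβτ]
      simp
    · change (π i).lTensor A _ = x₁ i
      simp only [map_add, map_sum, hcomp, hπσ, hπτ]
      rw [Finset.sum_eq_single i (by intro j _ h; simp [h.symm]) (by simp), if_pos rfl, ← hx' i,
          hcomp,
        ← LinearMap.add_apply, ← LinearMap.lTensor_add]
      exact (congrArg (fun f => LinearMap.lTensor A f (x₁ i)) hD).trans (by simp)
  · intro y hy
    let y' : A ⊗[R] TrivSqZeroExt R (Fin n → M) := y
    have h₀ : (β _).lTensor A y' = x₀ := hy none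
    have h₁ (i) : (π i).lTensor A y' = x₁ i := hy (some i)
    change y' = _
    have h := congrArg (fun f => LinearMap.lTensorHom A f y') hS
    simp only [map_add, map_sum, LinearMap.add_apply, LinearMap.sum_apply, LinearMap.coe_lTensorHom,
      LinearMap.lTensor_id, LinearMap.id_apply] at h
    simp only [← h₀, ← h₁, hcomp]
    exact h.symm

variable (R M) in
/-- `tszCone R M n` is a limit cone. -/
def tszConeIsLimit (n : ℕ) : IsLimit (tszCone R M n) :=
  isLimitOfReflects (𝟭 (CommAlgCat.{u} R))
    -- The case `A = R`, transported along `R ⊗ - ≅ id`.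
    (IsLimit.mapConeEquiv (leftUnitorNatIso _) (lTensor_tszCone_isLimit (𝟙_ _) n).some)

lemma preservesLimit_tszCospan_tensorLeft (A : CommAlgCat.{u} R) (n : ℕ) :
    PreservesLimit (tszCospan R M n) (tensorLeft A) :=
  preservesLimit_of_preserves_limit_cone (tszConeIsLimit R M n) (lTensor_tszCone_isLimit A n).some

end CommAlgCat

/-- The iterates of `D ⊗ -` are functors of the form `A ⊗ -`. -/
lemma exists_tensorIter_iso {C : Type u} [Category.{v} C] [MonoidalCategory C] (D : C) (k : ℕ) :
    ∃ A : C, Nonempty (tensorLeft A ≅ tensorIter D k) := by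
  induction k with
  | zero => exact ⟨𝟙_ C, ⟨leftUnitorNatIso C⟩⟩
  | succ k ih =>
    obtain ⟨A, ⟨e⟩⟩ := ih
    exact ⟨D ⊗ A, ⟨tensorLeftTensor D A ≪≫ Functor.isoWhiskerRight e (tensorLeft D)⟩⟩

namespace CommAlgCat

variable (R : Type u) [CommRing R] (M : Type u) [AddCommGroup M] [Module R M] [Module Rᵐᵒᵖ M]
  [IsCentralScalar R M]

/-- The augmentation of a trivial square-zero extension as the projection of a tangentoid. -/
def tszProj : TangentoidProj (CommAlgCat.of R (TrivSqZeroExt R M)) where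
  p := tszFst R M
  hasPullback n := inferInstanceAs (HasLimit (tszCospan R M n))
  preserves k n := by
    obtain ⟨A, ⟨e⟩⟩ := exists_tensorIter_iso (CommAlgCat.of R (TrivSqZeroExt R M)) k
    have := preservesLimit_tszCospan_tensorLeft (M := M) A n
    exact preservesLimit_of_natIso _ e

end CommAlgCat

/-! ### Tangentoids built from the symmetry and a square-zero augmentation. -/

lemma braiding_yang_baxter {C : Type u} [Category.{v} C] [MonoidalCategory C] [BraidedCategory C]
    (D : C) :
    D ◁ (β_ D D).hom ≫ ((α_ D D D).inv ≫ (β_ D D).hom ▷ D ≫ (α_ D D D).hom) ≫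
        D ◁ (β_ D D).hom =
      ((α_ D D D).inv ≫ (β_ D D).hom ▷ D ≫ (α_ D D D).hom) ≫ D ◁ (β_ D D).hom ≫
        ((α_ D D D).inv ≫ (β_ D D).hom ▷ D ≫ (α_ D D D).hom) := by
  simpa using (BraidedCategory.yang_baxter D D D).symm

/-- Naturality of the braiding in `l`, with the braiding of `D ⊗ D` past `D` expanded by the
hexagon. -/
lemma braiding_comp_whiskerLeft {C : Type u} [Category.{v} C] [MonoidalCategory C]
    [BraidedCategory C] {D : C} (l : D ⟶ D ⊗ D) :
    l ▷ D ≫ (α_ D D D).hom ≫ D ◁ (β_ D D).hom ≫ (α_ D D D).inv ≫ (β_ D D).hom ▷ D ≫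
      (α_ D D D).hom = (β_ D D).hom ≫ D ◁ l := by
  rw [← BraidedCategory.braiding_naturality_left, BraidedCategory.braiding_tensor_left_hom]

/-- The map `f + g - e` for algebra homomorphisms `f`, `g`, `e` with `(f - e) (g - e) = 0`. -/
def AlgHom.addSub {R A B : Type*} [CommRing R] [CommRing A] [CommRing B] [Algebra R A] [Algebra R B]
    (f g e : A →ₐ[R] B) (h : ∀ x y, (f x - e x) * (g y - e y) = 0) : A →ₐ[R] B :=
  AlgHom.ofLinearMap (f.toLinearMap + g.toLinearMap - e.toLinearMap) (by simp) (by
    intro x y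
    simp only [LinearMap.sub_apply, LinearMap.add_apply, AlgHom.toLinearMap_apply, map_mul]
    -- Writing `f = e + a` and `g = e + b`, the defect of multiplicativity is `a x * b y + b x * a
    -- y`.
    linear_combination -h x y - h y x)

namespace CommAlgCat

variable {R : Type u} [CommRing R] {D : CommAlgCat.{u} R} (P : TangentoidProj D)

/-- The projection of `D_n` to the base. -/
def powBase (n : ℕ) : P.pow n ⟶ 𝟙_ (CommAlgCat.{u} R) :=
  haveI := P.hasPullback n
  WidePullback.base (fun _ : Fin n => P.p)

lemma π_comp_p {n : ℕ} (i : Fin n) : P.π i ≫ P.p = powBase P n := by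
  have := P.hasPullback n
  exact WidePullback.π_arrow (fun _ : Fin n => P.p) i

lemma p_π {n : ℕ} (i : Fin n) (w : P.pow n) :
    P.p.hom ((P.π i).hom w) = (powBase P n).hom w :=
  congrArg (fun f => f.hom w) (π_comp_p P i)

/-- The base value `r` is recorded separately because for `n = 0` there are no components to
determine it: `D_0` is `R`. -/
lemma existsUnique_pow {n : ℕ} (r : R) (d : Fin n → D) (h : ∀ i, P.p.hom (d i) = r) :
    ∃! w : P.pow n, (powBase P n).hom w = r ∧ ∀ i, (P.π i).hom w = d i := by
  have := P.hasPullback n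
  have H := (nonempty_isLimit_iff _).1 ⟨limit.isLimit (WidePullbackShape.wideCospan
    (𝟙_ (CommAlgCat.{u} R)) (fun _ : Fin n => D) (fun _ => P.p))⟩
    (fun j => match j with | none => r | some i => d i) (by
      rintro i j (_ | i)
      · rw [WidePullbackShape.hom_id, CategoryTheory.Functor.map_id]; rfl
      · exact h i)
  obtain ⟨w, hw, huniq⟩ := H
  refine ⟨w, ⟨hw none, fun i => hw (some i)⟩, fun w' hw' => huniq w' ?_⟩
  rintro (_ | i)
  · exact hw'.1
  · exact hw'.2 i

lemma pow_ext {n : ℕ} {w w' : P.pow n} (h₀ : (powBase P n).hom w = (powBase P n).hom w')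
    (h : ∀ i, (P.π i).hom w = (P.π i).hom w') : w = w' :=
  (existsUnique_pow P _ (fun i => (P.π i).hom w') (fun i => p_π P i w')).unique ⟨h₀, h⟩ ⟨rfl,
      fun _ => rfl⟩

lemma pow_two_ext {w w' : P.pow 2} (h₀ : (P.π 0).hom w = (P.π 0).hom w')
    (h₁ : (P.π 1).hom w = (P.π 1).hom w') : w = w' := by
  refine pow_ext P ?_ ?_
  · rw [← p_π P 0, ← p_π P 0, h₀]
  · intro i; fin_cases i
    exacts [h₀, h₁]

lemma exists_pow_two (d₀ d₁ : D) (h : P.p.hom d₀ = P.p.hom d₁) :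
    ∃ w : P.pow 2, (P.π 0).hom w = d₀ ∧ (P.π 1).hom w = d₁ := by
  obtain ⟨w, hw, -⟩ := existsUnique_pow P (P.p.hom d₀) ![d₀, d₁]
      (by intro i; fin_cases i <;> simp [h])
  exact ⟨w, hw.2 0, hw.2 1⟩

lemma pair_π_zero_apply {X : CommAlgCat.{u} R} (f g : X ⟶ D) (h : f ≫ P.p = g ≫ P.p) (x : X) :
    (P.π 0).hom ((P.pair f g h).hom x) = f.hom x :=
  congrArg (fun k => k.hom x) (P.pair_π_zero f g h)

lemma pair_π_one_apply {X : CommAlgCat.{u} R} (f g : X ⟶ D) (h : f ≫ P.p = g ≫ P.p) (x : X) :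
    (P.π 1).hom ((P.pair f g h).hom x) = g.hom x :=
  congrArg (fun k => k.hom x) (P.pair_π_one f g h)

/-- The augmentation `p` as a homomorphism to `R`. -/
def counit : D →ₐ[R] R := P.p.hom

/-- The idempotent endomorphism `D → R → D` attached to the augmentation `p`. -/
def aug : D →ₐ[R] D := (Algebra.ofId R D).comp (counit P)

lemma aug_apply (d : D) : aug P d = algebraMap R D (counit P d) := rfl

@[simp]
lemma counit_aug (d : D) : counit P (aug P d) = counit P d := (counit P).commutes _

lemma counit_π {n : ℕ} (i j : Fin n) (w : P.pow n) :
    counit P ((P.π i).hom w) = counit P ((P.π j).hom w) :=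
  (p_π P i w).trans (p_π P j w).symm

lemma aug_π {n : ℕ} (i j : Fin n) (w : P.pow n) :
    aug P ((P.π i).hom w) = aug P ((P.π j).hom w) := by
  rw [aug_apply, aug_apply, counit_π P i j]

/-- The fibrewise addition `s : D_2 ⟶ D` is the addition of `D` up to the common augmentation. -/
def IsFiberAdd (s : P.pow 2 ⟶ D) : Prop :=
  ∀ w, s.hom w = (P.π 0).hom w + (P.π 1).hom w - aug P ((P.π 0).hom w)

variable {P}

/-- Both `f x` and `g x` are images of one element of `D ⊗ D_2`, and the formula is linear in that
element, so pure tensors suffice. -/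
lemma IsFiberAdd.tensorPair_apply {s : P.pow 2 ⟶ D} (hs : IsFiberAdd P s) {X : CommAlgCat.{u} R}
    (f g : X ⟶ D ⊗ D) (h : f ≫ D ◁ P.p = g ≫ D ◁ P.p) (x : X) :
    (P.tensorPair f g h ≫ D ◁ s).hom x =
      f.hom x + g.hom x - Algebra.TensorProduct.map (.id R D) (aug P) (f.hom x) := by
  have h₀ : f.hom x = (D ◁ P.π 0).hom ((P.tensorPair f g h).hom x) :=
    (congrArg (fun k => k.hom x) (P.tensorPair_π_zero f g h)).symm
  have h₁ : g.hom x = (D ◁ P.π 1).hom ((P.tensorPair f g h).hom x) :=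
    (congrArg (fun k => k.hom x) (P.tensorPair_π_one f g h)).symm
  rw [h₀, h₁]
  change (D ◁ s).hom ((P.tensorPair f g h).hom x) = _
  generalize (P.tensorPair f g h).hom x = y
  change D ⊗[R] P.pow 2 at y
  simp only [whiskerLeft_hom]
  induction y with
  | zero => simp
  | tmul d w => simp [hs w, TensorProduct.tmul_add, TensorProduct.tmul_sub]
  | add y y' hy hy' => simp only [map_add, hy, hy']; abel

variable (P) in
lemma map_aug (y : D ⊗[R] D) : Algebra.TensorProduct.map (.id R D) (aug P) y =
    ((D ◁ P.p ≫ (ρ_ D).hom).hom y : D) ⊗ₜ[R] (1 : D) := by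
  induction y with
  | zero => simp
  | add y y' hy hy' => simp only [map_add, hy, hy', TensorProduct.add_tmul]
  | tmul d e =>
    change d ⊗ₜ[R] aug P e = (counit P e • d) ⊗ₜ[R] (1 : D)
    rw [aug_apply, Algebra.algebraMap_eq_smul_one, TensorProduct.tmul_smul,
        TensorProduct.smul_tmul']

variable (P) in
/-- The fibrewise addition when the augmentation ideal has square zero. -/
def fiberAdd (hP : ∀ d e : D, counit P d = 0 → counit P e = 0 → d * e = 0) : P.pow 2 ⟶ D :=
  have h (d e : D) (hd : counit P d = counit P e) : counit P (d - aug P e) = 0 := by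
    rw [map_sub, counit_aug, hd, sub_self]
  ofHom (AlgHom.addSub (P.π 0).hom (P.π 1).hom ((aug P).comp (P.π 0).hom)
    fun (x y : P.pow 2) => hP _ _ (h _ _ rfl) (h _ _ (counit_π P 1 0 y)))

variable (P) in
lemma isFiberAdd_fiberAdd (hP : ∀ d e : D, counit P d = 0 → counit P e = 0 → d * e = 0) :
    IsFiberAdd P (fiberAdd P hP) := fun _ => rfl

lemma unit_hom_ext {X : CommAlgCat.{u} R} (f g : 𝟙_ (CommAlgCat.{u} R) ⟶ X) : f = g :=
  isInitialSelf.hom_ext f g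

/-- By `l_p`, both sides are the scalar `p d` placed in `D ⊗ D`. -/
lemma lift_map_aug (P : TangentoidProj D) (l : D ⟶ D ⊗ D)
    (l_p : l ≫ D ◁ P.p ≫ (ρ_ D).hom = P.p ≫ ofHom (Algebra.ofId R D)) (d : D) :
    Algebra.TensorProduct.map (.id R D) (aug P) (l.hom d) = l.hom (aug P d) :=
  (map_aug P (l.hom d)).trans
    ((congrArg (fun k : D ⟶ D => k.hom d ⊗ₜ[R] (1 : D)) l_p).trans (l.hom.commutes
        (counit P d)).symm)

/-- A tangentoid of commutative algebras from an augmentation whose ideal has square zero, a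
cocommutative coassociative `l`, and the symmetry of the tensor product. -/
def mkTangentoid (P : TangentoidProj D) (hP : ∀ d e : D, counit P d = 0 → counit P e = 0 → d * e =
    0)
    (l : D ⟶ D ⊗ D) (l_p : l ≫ D ◁ P.p ≫ (ρ_ D).hom = P.p ≫ ofHom (Algebra.ofId R D))
    (l_l : l ≫ D ◁ l = l ≫ l ▷ D ≫ (α_ D D D).hom) (l_c : l ≫ (β_ D D).hom = l)
    -- `inj` and `surj` are the universality of the vertical lift in elements: it sends `(d, e)`
    -- over `r` to `l d + 1 ⊗ e - r`. By linearity, injectivity need only be known over `r = 0`.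
    (inj : ∀ d e : D, counit P d = 0 → counit P e = 0 →
      l.hom d + (1 : D) ⊗ₜ[R] e = 0 → d = 0 ∧ e = 0)
    (surj : ∀ y : D ⊗[R] D, ∀ r : R,
      Algebra.TensorProduct.map (.id R D) (aug P) y = algebraMap R (D ⊗[R] D) r →
      ∃ d e : D, counit P d = r ∧ counit P e = r ∧
        l.hom d + (1 : D) ⊗ₜ[R] e - algebraMap R (D ⊗[R] D) r = y) : Tangentoid D where
  P := P
  z := ofHom (Algebra.ofId R D)
  s := fiberAdd P hP
  l := l
  c := (β_ D D).hom
  z_p := unit_hom_ext _ _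
  s_p := by
    refine hom_ext (AlgHom.ext fun w => ?_)
    change counit P ((fiberAdd P hP).hom w) = counit P ((P.π 0).hom w)
    simp [isFiberAdd_fiberAdd P hP w, counit_π P 1 0]
  s_comm := by
    refine hom_ext (AlgHom.ext fun w => ?_)
    simp [isFiberAdd_fiberAdd P hP _, pair_π_zero_apply, pair_π_one_apply, aug_π P 1 0]
    abel
  s_assoc := by
    refine hom_ext (AlgHom.ext fun w => ?_)
    simp [isFiberAdd_fiberAdd P hP _, pair_π_zero_apply, pair_π_one_apply, aug_π P 1 0,
      aug_apply P (aug P _), ← aug_apply]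
    abel
  z_s := by
    refine hom_ext (AlgHom.ext fun w => ?_)
    simp only [hom_comp, AlgHom.comp_apply, isFiberAdd_fiberAdd P hP _, pair_π_zero_apply,
      pair_π_one_apply]
    change aug P w + w - aug P (aug P w) = w
    simp [aug_apply P (aug P _), ← aug_apply]
  l_p := l_p
  z_l := unit_hom_ext _ _
  s_l := by
    refine hom_ext (AlgHom.ext fun w => ?_)
    rw [(isFiberAdd_fiberAdd P hP).tensorPair_apply]
    refine (congrArg (l.hom ((P.π 0).hom w) + l.hom ((P.π 1).hom w) - ·)
      (lift_map_aug P l l_p ((P.π 0).hom w))).trans ?_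
    simp [isFiberAdd_fiberAdd P hP w]
  c_p := by
    rw [← BraidedCategory.braiding_naturality_left_assoc]
    simp
  z_c := by
    rw [BraidedCategory.braiding_naturality_left]
    simp
  s_c := by
    refine hom_ext (Algebra.TensorProduct.ext' fun w d => ?_)
    rw [(isFiberAdd_fiberAdd P hP).tensorPair_apply]
    change d ⊗ₜ[R] (P.π 0).hom w + d ⊗ₜ[R] (P.π 1).hom w - d ⊗ₜ[R] aug P ((P.π 0).hom w) =
      d ⊗ₜ[R] (fiberAdd P hP).hom w
    rw [isFiberAdd_fiberAdd P hP w, TensorProduct.tmul_sub, TensorProduct.tmul_add]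
  l_l := l_l
  c_c := by
    refine hom_ext (Algebra.TensorProduct.ext' fun d e => ?_)
    rfl
  c_yang_baxter := by
    exact braiding_yang_baxter D
  l_c := l_c
  c_l := by
    exact braiding_comp_whiskerLeft l
  universal := by
    have key (h) (w : P.pow 2) :
        (P.tensorPair (P.π 0 ≫ l) (P.π 1 ≫ (λ_ D).inv ≫ ofHom (Algebra.ofId R D) ▷ D) h ≫
          D ◁ fiberAdd P hP).hom w = l.hom ((P.π 0).hom w) + (1 : D) ⊗ₜ[R] (P.π 1).hom w -
            algebraMap R (D ⊗[R] D) (counit P ((P.π 0).hom w)) := by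
      rw [(isFiberAdd_fiberAdd P hP).tensorPair_apply]
      refine congrArg₂ (· - ·) (congrArg₂ (· + ·) rfl ?_) ?_
      · change algebraMap R D 1 ⊗ₜ[R] (P.π 1).hom w = _
        rw [map_one]
      · exact (lift_map_aug P l l_p _).trans (l.hom.commutes _)
    rw [isPullback_iff]
    refine ⟨?_, ?_, ?_⟩
    · refine hom_ext (AlgHom.ext fun w => ?_)
      let q : D ⊗[R] D →ₐ[R] D := (D ◁ P.p ≫ (ρ_ D).hom).hom
      have hl (d : D) : q (l.hom d) = aug P d := congrArg (fun k : D ⟶ D => k.hom d) l_p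
      have hq (d : D) : q ((1 : D) ⊗ₜ[R] d) = aug P d :=
        (Algebra.algebraMap_eq_smul_one (counit P d)).symm
      refine (congrArg q (key _ w)).trans ?_
      rw [map_sub, map_add, hl, hq, q.commutes, aug_apply, aug_apply, counit_π P 1 0,
          add_sub_cancel_right]
      rfl
    · intro w w' h h'
      have h₀ : counit P ((P.π 0).hom w) = counit P ((P.π 0).hom w') := h'
      rw [key, key, h₀] at h
      obtain ⟨h₁, h₂⟩ := inj ((P.π 0).hom w - (P.π 0).hom w') ((P.π 1).hom w - (P.π 1).hom w')
        (by rw [map_sub, h₀, sub_self])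
        (by rw [map_sub, counit_π P 1 0, counit_π P 1 0, h₀, sub_self])
        (by
          rw [map_sub, TensorProduct.tmul_sub]
          linear_combination h)
      exact pow_two_ext P (sub_eq_zero.1 h₁) (sub_eq_zero.1 h₂)
    · intro y r h
      obtain ⟨d, e, hd, he, hy⟩ := surj y r ((map_aug P y).trans (congrArg (fun d : D => d ⊗ₜ[R]
          (1 : D)) h))
      obtain ⟨w, rfl, rfl⟩ := exists_pow_two P d e (hd.trans he.symm)
      refine ⟨w, ?_, hd⟩
      rw [key, hd]
      exact hy

end CommAlgCat

/-! ### The tangentoid of a solid algebra. -/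

namespace CommSolidAlg

open TrivSqZeroExt CommAlgCat

variable {R : Type u} [CommRing R] (M : CommSolidAlg R)

/-- The comultiplication of `M`: the inverse of the multiplication. -/
def comul : M ≃ₗ[R] M ⊗[R] M :=
  (LinearEquiv.ofBijective (LinearMap.mul' R M) M.bijective_mul).symm

@[simp]
lemma comul_mul (x y : M) : M.comul (x * y) = x ⊗ₜ y :=
  (LinearEquiv.symm_apply_eq _).2 rfl

@[elab_as_elim]
lemma induction_mul {motive : M → Prop} (zero : motive 0) (mul : ∀ x y, motive (x * y))
    (add : ∀ x y, motive x → motive y → motive (x + y)) (m : M) : motive m := by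
  obtain ⟨t, rfl⟩ := M.bijective_mul.2 m
  induction t with
  | zero => simpa using zero
  | tmul x y => exact mul x y
  | add t t' h h' => rw [map_add]; exact add _ _ h h'

lemma counit_tszProj (d : TrivSqZeroExt R M) : counit (tszProj R M) d = d.fst := rfl

lemma mul_eq_zero_of_counit (d e : M.semidirect) (hd : counit (tszProj R M) d = 0)
    (he : counit (tszProj R M) e = 0) : d * e = 0 := by
  change TrivSqZeroExt R M at d e
  rw [counit_tszProj] at hd he
  ext <;> simp [hd, he]

/-- The comultiplication as a linear map with square-zero image. -/
def liftLinear : { f : M →ₗ[R] TrivSqZeroExt R M ⊗[R] TrivSqZeroExt R M // ∀ x y, f x * f y = 0 } :=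
    ⟨TensorProduct.map (inrHom R M) (inrHom R M) ∘ₗ M.comul.toLinearMap, by
      intro x y
      simp only [LinearMap.comp_apply, LinearEquiv.coe_coe]
      generalize M.comul x = t
      generalize M.comul y = t'
      induction t with
      | zero => simp
      | add t₁ t₂ h₁ h₂ => simp [add_mul, h₁, h₂]
      | tmul a b =>
        induction t' with
        | zero => simp
        | add t₁ t₂ h₁ h₂ => rw [map_add, mul_add, h₁, h₂, add_zero]
        | tmul c d => simp⟩

/-- The vertical lift of `R ⋉ M`. -/
def liftHom : M.semidirect ⟶ M.semidirect ⊗ M.semidirect :=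
  ofHom (TrivSqZeroExt.liftEquivOfComm M.liftLinear)

lemma liftHom_inl (a : R) : M.liftHom.hom (inl a : TrivSqZeroExt R M) =
    (inl a : TrivSqZeroExt R M) ⊗ₜ[R] (1 : TrivSqZeroExt R M) :=
  M.liftHom.hom.commutes a

lemma liftHom_inr (m : M) : M.liftHom.hom (inr m : TrivSqZeroExt R M) =
    TensorProduct.map (inrHom R M) (inrHom R M) (M.comul m) :=
  DFunLike.congr_fun (congrArg Subtype.val
      (TrivSqZeroExt.liftEquivOfComm.symm_apply_apply M.liftLinear)) m

lemma liftHom_inr_mul (x y : M) : M.liftHom.hom (inr (x * y) : TrivSqZeroExt R M) =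
    (inr x : TrivSqZeroExt R M) ⊗ₜ[R] (inr y : TrivSqZeroExt R M) := by
  rw [liftHom_inr, comul_mul]; rfl

/-- Products span `M` because the multiplication is surjective. Every check on `R ⋉ M` thus reduces
to the formula `l(xy) = x ⊗ y`. -/
lemma semidirect_hom_ext {X : CommAlgCat.{u} R} {f g : M.semidirect ⟶ X}
    (h : ∀ x y : M, f.hom (inr (x * y) : TrivSqZeroExt R M) = g.hom (inr (x * y) :
        TrivSqZeroExt R M)) :
    f = g := by
  refine hom_ext (TrivSqZeroExt.algHom_ext fun m => ?_)
  induction m using M.induction_mul with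
  | zero => simp
  | mul x y => exact h x y
  | add x y hx hy => simp [hx, hy]


lemma liftHom_comp_counit : M.liftHom ≫ M.semidirect ◁ (tszProj R M).p ≫ (ρ_ M.semidirect).hom =
    (tszProj R M).p ≫ ofHom (Algebra.ofId R M.semidirect) := by
  refine M.semidirect_hom_ext fun x y => ?_
  refine (congrArg (M.semidirect ◁ (tszProj R M).p ≫ (ρ_ M.semidirect).hom).hom
      (M.liftHom_inr_mul x y)).trans ?_
  change (0 : R) • (inr x : TrivSqZeroExt R M) = algebraMap R (TrivSqZeroExt R M) 0
  rw [zero_smul, map_zero]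

/-- Both sides send `xyz` to `x ⊗ y ⊗ z`, by associativity; triple products also span `M`. -/
lemma liftHom_coassoc : M.liftHom ≫ M.semidirect ◁ M.liftHom =
    M.liftHom ≫ M.liftHom ▷ M.semidirect ≫ (α_ _ _ _).hom := by
  refine M.semidirect_hom_ext fun x y => ?_
  induction y using M.induction_mul with
  | zero => simp
  | add y z hy hz => simp only [mul_add, inr_add, map_add, hy, hz]
  | mul y z =>
    refine (congrArg (M.semidirect ◁ M.liftHom).hom (M.liftHom_inr_mul x (y * z))).trans ?_
    rw [← mul_assoc]
    refine Eq.trans ?_ (congrArg (M.liftHom ▷ M.semidirect ≫ (α_ _ _ _).hom).hom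
      (M.liftHom_inr_mul (x * y) z)).symm
    refine (congrArg ((inr x : TrivSqZeroExt R M) ⊗ₜ[R] ·) (M.liftHom_inr_mul y z)).trans ?_
    exact (congrArg (fun t => (α_ M.semidirect M.semidirect M.semidirect).hom.hom
      (t ⊗ₜ[R] (inr z : TrivSqZeroExt R M))) (M.liftHom_inr_mul x y)).symm

lemma liftHom_cocomm : M.liftHom ≫ (β_ _ _).hom = M.liftHom := by
  refine M.semidirect_hom_ext fun x y => ?_
  refine (congrArg (β_ M.semidirect M.semidirect).hom.hom (M.liftHom_inr_mul x y)).trans ?_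
  rw [mul_comm]
  exact (M.liftHom_inr_mul y x).symm

/-- The projection of `(R ⋉ M) ⊗ (R ⋉ M)` onto `M ⊗ M`. -/
def sndTensor : TrivSqZeroExt R M ⊗[R] TrivSqZeroExt R M →ₗ[R] M ⊗[R] M :=
  TensorProduct.map (sndHom R M) (sndHom R M)

/-- The projection of `(R ⋉ M) ⊗ (R ⋉ M)` onto its second factor. -/
def counitLeft : TrivSqZeroExt R M ⊗[R] TrivSqZeroExt R M →ₐ[R] TrivSqZeroExt R M :=
  (Algebra.TensorProduct.lid R _).toAlgHom.comp (Algebra.TensorProduct.map (fstHom R R M) (.id R _))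

lemma sndTensor_liftHom_inr (m : M) :
    M.sndTensor (M.liftHom.hom (inr m : TrivSqZeroExt R M)) = M.comul m := by
  induction m using M.induction_mul with
  | zero => simp
  | mul x y => rw [liftHom_inr_mul, comul_mul]; simp [sndTensor]
  | add x y hx hy => simp only [inr_add, map_add, hx, hy]

lemma counitLeft_liftHom_inr (m : M) :
    M.counitLeft (M.liftHom.hom (inr m : TrivSqZeroExt R M)) = 0 := by
  induction m using M.induction_mul with
  | zero => simp
  | mul x y => rw [liftHom_inr_mul]; simp [counitLeft]
  | add x y hx hy => simp only [inr_add, map_add, hx, hy, add_zero]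

/-- `counitLeft` kills `l(M)` and recovers `e`; once `e = 0`, `sndTensor` recovers the injective
`comul` of `d`. -/
lemma liftHom_inj (d e : M.semidirect) (hd : counit (tszProj R M) d = 0)
    (he : counit (tszProj R M) e = 0)
    (h : M.liftHom.hom d + (1 : M.semidirect) ⊗ₜ[R] e = 0) : d = 0 ∧ e = 0 := by
  change TrivSqZeroExt R M at d e
  rw [counit_tszProj] at hd he
  obtain ⟨m, rfl⟩ : ∃ m, d = inr m := ⟨d.snd, by ext <;> simp [hd]⟩
  obtain ⟨n, rfl⟩ : ∃ n, e = inr n := ⟨e.snd, by ext <;> simp [he]⟩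
  have hn : (inr n : TrivSqZeroExt R M) = 0 := by
    have := congrArg M.counitLeft h
    rw [map_add, counitLeft_liftHom_inr, map_zero, zero_add] at this
    simpa [counitLeft] using this
  refine ⟨?_, hn⟩
  have := congrArg M.sndTensor h
  rw [hn, TensorProduct.tmul_zero, add_zero, sndTensor_liftHom_inr, map_zero] at this
  rw [M.comul.map_eq_zero_iff.1 this, inr_zero]

/-- Inclusion-exclusion for `(R ⊕ M) ⊗ (R ⊕ M)`: the parts in `M ⊗ M`, `1 ⊗ D` and `D ⊗ 1`, minus
the scalar part counted twice. -/
lemma tensor_decomposition (y : TrivSqZeroExt R M ⊗[R] TrivSqZeroExt R M) :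
    y = TensorProduct.map (inrHom R M) (inrHom R M) (M.sndTensor y) + 1 ⊗ₜ[R] M.counitLeft y +
      Algebra.TensorProduct.map (.id R _) (aug (tszProj R M)) y -
      1 ⊗ₜ[R] aug (tszProj R M) (M.counitLeft y) := by
  induction y with
  | zero => simp
  | add y z hy hz =>
    conv_lhs => rw [hy, hz]
    simp only [map_add, TensorProduct.tmul_add]
    abel
  | tmul d e =>
    have h₁ : inr d.snd = d - inl d.fst := by rw [eq_sub_iff_add_eq, add_comm,
        inl_fst_add_inr_snd_eq]
    have h₂ : inr e.snd = e - inl e.fst := by rw [eq_sub_iff_add_eq, add_comm,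
        inl_fst_add_inr_snd_eq]
    have h₃ : (1 : TrivSqZeroExt R M) ⊗ₜ[R] (d.fst • e) = inl d.fst ⊗ₜ[R] e := by
      rw [TensorProduct.tmul_smul, TensorProduct.smul_tmul', ← Algebra.algebraMap_eq_smul_one]; rfl
    have h₄ : (1 : TrivSqZeroExt R M) ⊗ₜ[R] (inl (d.fst * e.fst) : TrivSqZeroExt R M) =
        inl d.fst ⊗ₜ[R] inl e.fst := by
      rw [← smul_eq_mul, inl_smul, TensorProduct.tmul_smul, TensorProduct.smul_tmul',
          ← Algebra.algebraMap_eq_smul_one]; rfl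
    change _ = inr d.snd ⊗ₜ[R] inr e.snd + (1 : TrivSqZeroExt R M) ⊗ₜ[R] (d.fst • e) +
      d ⊗ₜ[R] (inl e.fst : TrivSqZeroExt R M) - (1 : TrivSqZeroExt R M) ⊗ₜ[R] inl (d.fst * e.fst)
    rw [h₁, h₂, h₃, h₄, TensorProduct.tmul_sub, TensorProduct.sub_tmul, TensorProduct.sub_tmul]
    abel

lemma liftHom_surj (y : M.semidirect ⊗[R] M.semidirect) (r : R)
    (h : Algebra.TensorProduct.map (.id R M.semidirect) (aug (tszProj R M)) y =
      algebraMap R (M.semidirect ⊗[R] M.semidirect) r) :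
    ∃ d e : M.semidirect, counit (tszProj R M) d = r ∧ counit (tszProj R M) e = r ∧
      M.liftHom.hom d + (1 : M.semidirect) ⊗ₜ[R] e -
        algebraMap R (M.semidirect ⊗[R] M.semidirect) r = y := by
  have he : aug (tszProj R M) (M.counitLeft y) = algebraMap R M.semidirect r := by
    have h' : M.counitLeft (Algebra.TensorProduct.map (.id R M.semidirect) (aug (tszProj R M)) y) =
        aug (tszProj R M) (M.counitLeft y) := by
      clear h
      induction y with
      | zero => simp
      | add y z hy hz => simp only [map_add, hy, hz]
      | tmul d e =>
        change fst d • aug (tszProj R M) e = aug (tszProj R M) (fst d • e)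
        rw [map_smul]
    rw [← h', h, AlgHom.commutes]
  -- The hypothesis makes the part in `D ⊗ 1` the scalar `r`. What remains is the part in `1 ⊗ D`,
  -- which gives `e`, and the part in `M ⊗ M`, which `comul` lifts back to `M`.
  refine ⟨(inl r : TrivSqZeroExt R M) + inr (M.comul.symm (M.sndTensor y)), M.counitLeft y, ?_, ?_,
      ?_⟩
  · exact (counit_tszProj M _).trans (by simp)
  · exact congrArg fst he
  · conv_rhs => rw [M.tensor_decomposition y]
    have h₁ : M.liftHom.hom (inl r : TrivSqZeroExt R M) = algebraMap R _ r :=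
        M.liftHom.hom.commutes r
    refine Eq.trans ?_ (congrArg₂ (fun s t => TensorProduct.map (inrHom R M) (inrHom R M)
        (M.sndTensor y) +
      1 ⊗ₜ[R] M.counitLeft y + s - 1 ⊗ₜ[R] t) h he).symm
    have h₂ : (1 : TrivSqZeroExt R M) ⊗ₜ[R] algebraMap R (TrivSqZeroExt R M) r =
        algebraMap R _ r := by
      rw [Algebra.algebraMap_eq_smul_one, TensorProduct.tmul_smul,
          Algebra.algebraMap_eq_smul_one]; rfl
    refine Eq.trans ?_ (congrArg (_ - ·) h₂.symm)
    rw [map_add, h₁, liftHom_inr, LinearEquiv.apply_symm_apply]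
    generalize (algebraMap R _ r : TrivSqZeroExt R M ⊗[R] TrivSqZeroExt R M) = t
    exact congrArg (· - t) (by rw [add_comm t, add_right_comm])

/-- The tangentoid structure on `R ⋉ M`. -/
def tangentoid : Tangentoid M.semidirect :=
  mkTangentoid (tszProj R M) M.mul_eq_zero_of_counit M.liftHom M.liftHom_comp_counit M.liftHom_coassoc
    M.liftHom_cocomm M.liftHom_inj M.liftHom_surj

lemma isAssociated_tangentoid : M.IsAssociated M.tangentoid where
  p_apply _ := rfl
  z_apply _ := rfl
  s_apply w := by
    have h := (p_π (tszProj R M) 0 w).trans (p_π (tszProj R M) 1 w).symm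
    refine (isFiberAdd_fiberAdd (tszProj R M) M.mul_eq_zero_of_counit w).trans ?_
    change ((tszProj R M).π 0).hom w + ((tszProj R M).π 1).hom w - inl (fst
        (((tszProj R M).π 0).hom w)) =
      inl (fst (((tszProj R M).π 0).hom w)) +
        inr (snd (((tszProj R M).π 0).hom w) + snd (((tszProj R M).π 1).hom w))
    generalize ((tszProj R M).π 0).hom w = d at h ⊢
    generalize ((tszProj R M).π 1).hom w = e at h ⊢
    change TrivSqZeroExt R M at d e
    change d.fst = e.fst at h
    ext <;> simp [h]
  l_inl := M.liftHom_inl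
  l_inr := M.liftHom_inr_mul
  c_apply _ _ := rfl

lemma IsAssociated.ext {T T' : Tangentoid M.semidirect} (h : M.IsAssociated T)
    (h' : M.IsAssociated T') : T = T' := by
  have hp : T.P.p = T'.P.p := hom_ext (AlgHom.ext fun d => (h.p_apply d).trans (h'.p_apply d).symm)
  have hz : T.z = T'.z := unit_hom_ext _ _
  have hl : T.l = T'.l :=
    M.semidirect_hom_ext fun x y => (h.l_inr x y).trans (h'.l_inr x y).symm
  have hc : T.c = T'.c := hom_ext (Algebra.TensorProduct.ext' fun d e =>
    (h.c_apply d e).trans (h'.c_apply d e).symm)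
  have hs := h.s_apply
  have hs' := h'.s_apply
  clear h h'
  obtain ⟨⟨p, _, _⟩, z, s, l, c⟩ := T
  obtain ⟨⟨p', _, _⟩, z', s', l', c'⟩ := T'
  dsimp only at hp hz hl hc
  subst hp hz hl hc
  -- The source of `s` depends on `p`, so the two sums are comparable only after the projections are
  -- identified.
  have hss : s = s' := hom_ext (AlgHom.ext fun w => (hs w).trans (hs' w).symm)
  subst hss
  rfl

end CommSolidAlg

/-! ### Finite presentation from commutation with powers of `R`. -/

section Modules

variable {R : Type u} [CommRing R] {N : Type u} [AddCommGroup N] [Module R N]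

/-- If `t = ∑ nᵢ ⊗ gᵢ` represents the identity family, then `n = ∑ gᵢ(n) nᵢ` for every `n`, so the
`nᵢ` generate. -/
lemma Module.Finite.of_piScalarRightHom_eq_id (t : N ⊗[R] (N → R))
    (ht : TensorProduct.piScalarRightHom R R N N t = id) : Module.Finite R N := by
  classical
  obtain ⟨S, rfl⟩ := TensorProduct.exists_finset t
  refine ⟨⟨S.image Prod.fst, eq_top_iff.2 fun n _ => ?_⟩⟩
  have h := congrFun ht n
  simp only [map_sum, TensorProduct.piScalarRightHom_tmul, Finset.sum_apply, id] at h
  rw [← h]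
  refine Submodule.sum_mem _ fun i hi => Submodule.smul_mem _ _ (Submodule.subset_span ?_)
  exact Finset.mem_image_of_mem _ hi

lemma piScalarRightHom_rTensor {N' : Type u} [AddCommGroup N'] [Module R N'] {I : Type u}
    (f : N →ₗ[R] N') (t : N ⊗[R] (I → R)) :
    TensorProduct.piScalarRightHom R R N' I (f.rTensor (I → R) t) =
      fun i => f (TensorProduct.piScalarRightHom R R N I t i) := by
  induction t with
  | zero => ext; simp
  | add t t' h h' => ext; simp [h, h']
  | tmul n g => ext; simp

/-- A module for which the maps `N ⊗ R ^ I → N ^ I` are bijective is finitely presented. -/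
lemma Module.FinitePresentation.of_piScalarRightHom_bijective
    (h : ∀ I : Type u, Function.Bijective (TensorProduct.piScalarRightHom R R N I)) :
    Module.FinitePresentation R N := by
  obtain ⟨t, ht⟩ := (h N).2 id
  have := Module.Finite.of_piScalarRightHom_eq_id t ht
  obtain ⟨n, f, hf⟩ := Module.Finite.exists_fin' R N
  refine Module.finitePresentation_of_surjective f hf ?_
  rw [← Module.Finite.iff_fg]
  let K := LinearMap.ker f
  -- `t` represents the inclusion `K → Rⁿ`. It dies in `N ⊗ R^K` by injectivity for `I = K`, so
  -- right exactness lifts it to `K ⊗ R^K`, where the lift represents the identity of `K`.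
  let t : (Fin n → R) ⊗[R] (K → R) := ∑ i, Pi.single i (1 : R) ⊗ₜ (fun ν : K => ν.1 i)
  have ht : TensorProduct.piScalarRightHom R R (Fin n → R) K t = Subtype.val := by
    ext ν j
    simp [t, Finset.sum_apply, Pi.single_apply]
  have hft : f.rTensor (K → R) t = 0 := by
    refine (h K).1 ?_
    rw [piScalarRightHom_rTensor, ht, map_zero]
    ext ν
    exact ν.2
  have hex : Function.Exact K.subtype f := LinearMap.exact_subtype_ker_map f
  obtain ⟨s, hs⟩ := (rTensor_exact (K → R) hex hf t).1 hft
  refine Module.Finite.of_piScalarRightHom_eq_id s ?_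
  ext ν : 1
  refine Subtype.ext ?_
  have := congrFun (piScalarRightHom_rTensor K.subtype s) ν
  rw [hs, ht] at this
  exact this.symm

end Modules

/-! ### Tensoring with `B` is a right adjoint exactly for finite projective `B`. -/

namespace CommAlgCat

variable {R : Type u} [CommRing R] (B : CommAlgCat.{u} R)

/-- The algebra `R^I` is the product of `I` copies of `R`, and `B ⊗ -` preserves this product. -/
lemma piScalarRightHom_bijective [PreservesLimits (tensorLeft B)] (I : Type u) :
    Function.Bijective (TensorProduct.piScalarRightHom R R B I) := by
  let F : Discrete I ⥤ CommAlgCat.{u} R := Discrete.functor fun _ => of R R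
  let c : Cone F := Fan.mk (of R (I → R)) fun i => ofHom (Pi.evalAlgHom R (fun _ => R) i)
  have hc : Nonempty (IsLimit c) := by
    rw [nonempty_isLimit_iff]
    intro x hx
    refine ⟨fun i => x ⟨i⟩, fun j => rfl, fun y hy => ?_⟩
    exact funext fun i => hy ⟨i⟩
  have h := (nonempty_isLimit_iff _).1 ⟨isLimitOfPreserves (tensorLeft B) hc.some⟩
  have hπ (y : B ⊗[R] (I → R)) (i : I) : TensorProduct.piScalarRightHom R R B I y i =
      TensorProduct.rid R B (((tensorLeft B).map (c.π.app ⟨i⟩)).hom y) := by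
    induction y with
    | zero => simp
    | add y z hy hz =>
      simp only [map_add, Pi.add_apply, hy, hz]
    | tmul b g => simp; rfl
  rw [Function.bijective_iff_existsUnique]
  intro d
  obtain ⟨y, hy, huniq⟩ := h (fun i => (TensorProduct.rid R B).symm (d i.as)) (by
    rintro ⟨i⟩ ⟨j⟩ f
    obtain rfl : i = j := Discrete.eq_of_hom f
    obtain rfl : f = 𝟙 _ := Subsingleton.elim _ _
    rw [CategoryTheory.Functor.map_id]
    rfl)
  refine ⟨y, ?_, fun z hz => huniq z fun i => ?_⟩
  · ext i
    rw [hπ]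
    exact (congrArg _ (hy ⟨i⟩)).trans (LinearEquiv.apply_symm_apply _ _)
  · refine (LinearEquiv.eq_symm_apply _).2 ?_
    rw [← hz]
    exact (hπ z i.as).symm

/-- A linear injection `N → N'` becomes a monomorphism of algebras `R ⋉ N → R ⋉ N'`, which `B ⊗ -`
preserves; `B ⊗ N` sits inside `B ⊗ (R ⋉ N)` as a retract. -/
lemma flat_of_preservesLimits [PreservesLimits (tensorLeft B)] : Module.Flat R B := by
  rw [Module.Flat.iff_lTensor_preserves_injective_linearMap]
  intro N N' _ _ _ _ f hf
  let _ : Module Rᵐᵒᵖ N := Module.compHom N ((RingHom.id R).fromOpposite fun _ _ => mul_comm _ _)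
  let _ : Module Rᵐᵒᵖ N' := Module.compHom N' ((RingHom.id R).fromOpposite fun _ _ => mul_comm _ _)
  have : IsCentralScalar R N := ⟨fun _ _ => rfl⟩
  have : IsCentralScalar R N' := ⟨fun _ _ => rfl⟩
  let φ : of R (TrivSqZeroExt R N) ⟶ of R (TrivSqZeroExt R N') := ofHom (TrivSqZeroExt.map f)
  have : Mono φ := mono_of_injective _ (by
    intro x y h
    have h₁ := congrArg TrivSqZeroExt.fst h
    have h₂ := congrArg TrivSqZeroExt.snd h
    simp [φ] at h₁ h₂
    exact TrivSqZeroExt.ext h₁ (hf h₂))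
  have hinj := injective_of_mono ((tensorLeft B).map φ)
  have hN : Function.Injective ((TrivSqZeroExt.inrHom R N).lTensor B) :=
    Function.LeftInverse.injective (g := (TrivSqZeroExt.sndHom R N).lTensor B) fun x => by
      rw [← LinearMap.lTensor_comp_apply]
      exact (congrArg (fun k => LinearMap.lTensor B k x) (by ext; simp)).trans
          (LinearMap.lTensor_id_apply _ _ _)
  refine Function.Injective.of_comp (f := (TrivSqZeroExt.inrHom R N').lTensor B) ?_
  have : (TrivSqZeroExt.inrHom R N').lTensor B ∘ f.lTensor B =
      ((tensorLeft B).map φ).hom ∘ (TrivSqZeroExt.inrHom R N).lTensor B := by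
    ext y
    change _ = (TrivSqZeroExt.map f).toLinearMap.lTensor B _
    simp only [Function.comp_apply, ← LinearMap.lTensor_comp_apply]
    congr 2
    ext <;> simp
  rw [this]
  exact hinj.comp hN

lemma finite_projective_of_isRightAdjoint [(tensorLeft B).IsRightAdjoint] :
    Module.Finite R B ∧ Module.Projective R B := by
  have := (Adjunction.ofIsRightAdjoint (tensorLeft B)).rightAdjoint_preservesLimits
  have := flat_of_preservesLimits B
  have := Module.FinitePresentation.of_piScalarRightHom_bijective (piScalarRightHom_bijective B)
  exact ⟨inferInstance, Module.Flat.projective_of_finitePresentation⟩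

variable {B}

/-- The coordinate of an element of `B ⊗ X` along a linear form on `B`. -/
def coord (ξ : B →ₗ[R] R) (X : CommAlgCat.{u} R) : B ⊗[R] X →ₗ[R] X :=
  (TensorProduct.lid R X).toLinearMap ∘ₗ ξ.rTensor X

lemma coord_naturality (ξ : B →ₗ[R] R) {X Y : CommAlgCat.{u} R} (f : X ⟶ Y) (x : B ⊗[R] X) :
    coord ξ Y (((tensorLeft B).map f).hom x) = f.hom (coord ξ X x) := by
  induction x with
  | zero => simp
  | add x y hx hy => simp only [map_add, ← hx, ← hy]
  | tmul b x => simp [coord]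

lemma sum_tmul_coord {n : ℕ} {e : Fin n → B} {ξ : Fin n → B →ₗ[R] R}
    (h : ∀ b, ∑ i, ξ i b • e i = b) {X : CommAlgCat.{u} R} (x : B ⊗[R] X) :
    ∑ i, e i ⊗ₜ[R] coord (ξ i) X x = x := by
  induction x with
  | zero => simp
  | add x y hx hy => simp only [map_add, TensorProduct.tmul_add, Finset.sum_add_distrib, hx, hy]
  | tmul b x =>
    simp only [coord, LinearMap.comp_apply, LinearMap.rTensor_tmul, LinearEquiv.coe_coe,
        TensorProduct.lid_tmul,
      ← TensorProduct.smul_tmul, ← TensorProduct.sum_tmul, h]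

variable (B)

lemma exists_dual_basis [Module.Finite R B] [Module.Projective R B] :
    ∃ (n : ℕ) (e : Fin n → B) (ξ : Fin n → B →ₗ[R] R), ∀ b, ∑ i, ξ i b • e i = b := by
  obtain ⟨n, f, g, -, -, h⟩ := Module.Finite.exists_comp_eq_id_of_projective R B
  refine ⟨n, fun i => f (Pi.single i 1), fun i => LinearMap.proj i ∘ₗ g, fun b => ?_⟩
  have := LinearMap.congr_fun h b
  conv_rhs => rw [← LinearMap.id_apply (R := R) b, ← h]
  simp only [LinearMap.comp_apply, LinearMap.proj_apply, ← map_smul, ← map_sum]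
  congr 1
  ext j
  simp [Finset.sum_apply, Pi.single_apply]

/-- Taking coordinates along a dual basis turns a compatible family in `B ⊗ F` into finitely many
compatible families in `F`, and `sum_tmul_coord` reassembles their limits. -/
lemma preservesLimits_tensorLeft [Module.Finite R B] [Module.Projective R B] :
    PreservesLimits (tensorLeft B) := by
  obtain ⟨n, e, ξ, h⟩ := exists_dual_basis B
  refine ⟨fun {J} _ => ⟨fun {F} => ⟨fun {c} hc => ?_⟩⟩⟩
  have H := (nonempty_isLimit_iff c).1 ⟨hc⟩
  rw [nonempty_isLimit_iff]
  intro x hx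
  have hy (i : Fin n) := H (fun j => coord (ξ i) (F.obj j) (x j)) (fun j k f => by
    rw [← coord_naturality, ← hx j k f]; rfl)
  choose y hy huniq using hy
  refine ⟨∑ i, e i ⊗ₜ[R] y i, fun j => ?_, fun z hz => ?_⟩
  · change ((tensorLeft B).map (c.π.app j)).hom (∑ i, e i ⊗ₜ[R] y i) = x j
    rw [map_sum]
    refine Eq.trans ?_ (sum_tmul_coord h (X := F.obj j) (x j))
    exact Finset.sum_congr rfl fun i _ => congrArg (e i ⊗ₜ[R] ·) (hy i j)
  · rw [← sum_tmul_coord h (X := c.pt) z]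
    refine Finset.sum_congr rfl fun i _ => congrArg (e i ⊗ₜ[R] ·) (huniq i _ fun j => ?_)
    rw [← hz j]
    exact (coord_naturality (ξ i) (c.π.app j) z).symm

/-- An algebra homomorphism whose values lie in the image of an injective homomorphism factors
through it. -/
lemma _root_.AlgHom.exists_factorization {A X Y : Type*} [CommRing A] [CommRing X] [CommRing Y]
    [Algebra R A] [Algebra R X] [Algebra R Y] (i : X →ₐ[R] Y) (hi : Function.Injective i)
    (h : A →ₐ[R] Y) (hh : ∀ a, ∃ x, i x = h a) : ∃ f : A →ₐ[R] X, i.comp f = h := by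
  refine ⟨(AlgEquiv.ofInjective i hi).symm.toAlgHom.comp (h.codRestrict i.range hh), ?_⟩
  ext a
  have := (AlgEquiv.ofInjective i hi).apply_symm_apply (h.codRestrict i.range hh a)
  exact congrArg Subtype.val this

lemma isRightAdjoint_tensorLeft [Module.Finite R B] [Module.Projective R B] :
    (tensorLeft B).IsRightAdjoint := by
  have := preservesLimits_tensorLeft B
  obtain ⟨n, e, ξ, he⟩ := exists_dual_basis B
  refine isRightAdjoint_of_preservesLimits_of_solutionSetCondition _ fun A => ?_
  -- Solution set: a map `h : A → B ⊗ X` involves only the coordinates of the `h a`. They generate a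
  -- subalgebra of `X` that is a quotient of the polynomial ring on `A × Fin n`, and by flatness `B
  -- ⊗ -` keeps its inclusion injective.
  refine ⟨Σ I : Ideal (MvPolynomial (A × Fin n) R),
    (A ⟶ B ⊗ of R (MvPolynomial (A × Fin n) R ⧸ I)), fun i => of R (_ ⧸ i.1), fun i => i.2, ?_⟩
  intro X h
  let φ : MvPolynomial (A × Fin n) R →ₐ[R] X :=
    MvPolynomial.aeval fun a => coord (ξ a.2) X (h.hom a.1)
  let ψ : of R (MvPolynomial (A × Fin n) R ⧸ RingHom.ker φ) ⟶ X := ofHom (Ideal.kerLiftAlg φ)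
  have hψ : Function.Injective ψ.hom := Ideal.kerLiftAlg_injective φ
  obtain ⟨f, hf⟩ := AlgHom.exists_factorization ((tensorLeft B).map ψ).hom
    (Module.Flat.lTensor_preserves_injective_linearMap (M := B) ψ.hom.toLinearMap hψ) h.hom
        (fun a => by
      refine ⟨∑ i, e i ⊗ₜ[R] Ideal.Quotient.mk _ (MvPolynomial.X (a, i)), ?_⟩
      rw [map_sum]
      refine Eq.trans ?_ (sum_tmul_coord he (X := X) (h.hom a))
      refine Finset.sum_congr rfl fun i _ => congrArg (e i ⊗ₜ[R] ·) ?_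
      exact (Ideal.kerLiftAlg_mk φ _).trans (by simp [φ]))
  exact ⟨⟨RingHom.ker φ, ofHom f⟩, ψ, hom_ext hf⟩

lemma isRightAdjoint_tensorLeft_iff :
    (tensorLeft B).IsRightAdjoint ↔ Module.Finite R B ∧ Module.Projective R B :=
  ⟨fun _ => finite_projective_of_isRightAdjoint B, fun ⟨_, _⟩ => isRightAdjoint_tensorLeft B⟩

end CommAlgCat

/-! ### The augmentation ideal and coexponentiability. -/

namespace CommAlgCat

variable {R : Type u} [CommRing R] {D : CommAlgCat.{u} R} (P : TangentoidProj D)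

/-- The augmentation ideal, as a module. -/
abbrev augIdeal : Submodule R D := LinearMap.ker (counit P).toLinearMap

/-- The projection of `D` onto the augmentation ideal. -/
def augProj : D →ₗ[R] augIdeal P :=
  (LinearMap.id - (aug P).toLinearMap).codRestrict _ fun d => by simp

@[simp]
lemma coe_augProj (d : D) : (augProj P d : D) = d - aug P d := rfl

lemma aug_coe (k : augIdeal P) : aug P k = 0 := by
  rw [aug_apply, show counit P k = 0 from k.2, map_zero]

@[simp]
lemma augProj_coe (k : augIdeal P) : augProj P k = k :=
  Subtype.ext (by rw [coe_augProj, aug_coe, sub_zero])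

lemma augProj_one : augProj P 1 = 0 := Subtype.ext (by simp)

lemma augProj_comp_subtype : augProj P ∘ₗ (augIdeal P).subtype = LinearMap.id :=
  LinearMap.ext (augProj_coe P)

/-- The module underlying `D_n` is `R ⊕ Kⁿ`, where `K` is the augmentation ideal. -/
def powEquiv (n : ℕ) : P.pow n ≃ₗ[R] R × (Fin n → augIdeal P) :=
  LinearEquiv.ofBijective
    (LinearMap.prod (M₂ := R) (powBase P n).hom.toLinearMap
      (LinearMap.pi fun i => augProj P ∘ₗ (P.π i).hom.toLinearMap)) (by
    rw [Function.bijective_iff_existsUnique]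
    rintro ⟨r, k⟩
    have hc (d : D) (h : counit P d = r) : aug P d = algebraMap R D r := by rw [aug_apply, h]
    obtain ⟨w, ⟨h₀, h₁⟩, huniq⟩ := existsUnique_pow P r (fun i => (k i : D) + algebraMap R D r)
      (fun i => by
        change counit P _ = r
        rw [map_add, AlgHom.commutes, show counit P (k i) = 0 from (k i).2, zero_add]
        rfl)
    refine ⟨w, Prod.ext h₀ (funext fun i => Subtype.ext ?_), fun w' hw' => huniq w'
        ⟨congrArg Prod.fst hw', fun i => ?_⟩⟩
    · change (P.π i).hom w - aug P ((P.π i).hom w) = k i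
      rw [hc _ ((p_π P i w).trans h₀), h₁, add_sub_cancel_right]
    · have h : (P.π i).hom w' - aug P ((P.π i).hom w') = k i :=
        congrArg Subtype.val (congrFun (congrArg Prod.snd hw') i)
      rw [← h, hc _ ((p_π P i w').trans (congrArg Prod.fst hw')), sub_add_cancel])

lemma finite_projective_pow [Module.Finite R (augIdeal P)] [Module.Projective R (augIdeal P)] (n :
    ℕ) :
    Module.Finite R (P.pow n) ∧ Module.Projective R (P.pow n) :=
  have : Module.Projective R (Fin n → augIdeal P) :=
    Module.Projective.of_equiv (DFinsupp.linearEquivFunOnFintype (R := R) (M := fun _ : Fin n =>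
        augIdeal P))
  ⟨Module.Finite.equiv (powEquiv P n).symm, Module.Projective.of_equiv (powEquiv P n).symm⟩

lemma finite_projective_augIdeal_of_pow [Module.Finite R (P.pow 1)] [Module.Projective R
    (P.pow 1)] :
    Module.Finite R (augIdeal P) ∧ Module.Projective R (augIdeal P) := by
  let f : P.pow 1 →ₗ[R] augIdeal P := LinearMap.proj 0 ∘ₗ LinearMap.snd R R _ ∘ₗ
      (powEquiv P 1).toLinearMap
  let g : augIdeal P →ₗ[R] P.pow 1 := (powEquiv P 1).symm.toLinearMap ∘ₗ LinearMap.inr R R _ ∘ₗ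
    LinearMap.pi fun _ => LinearMap.id
  have h : f ∘ₗ g = LinearMap.id := by ext; simp [f, g]
  exact ⟨Module.Finite.of_surjective f fun k => ⟨g k, LinearMap.congr_fun h k⟩,
    Module.Projective.of_split g f h⟩

lemma finite_projective_augIdeal [Module.Finite R D] [Module.Projective R D] :
    Module.Finite R (augIdeal P) ∧ Module.Projective R (augIdeal P) :=
  ⟨Module.Finite.of_surjective (augProj P) fun k => ⟨k, augProj_coe P k⟩,
    Module.Projective.of_split _ _ (augProj_comp_subtype P)⟩

/-- `D_n ≅ R ⊕ Kⁿ` as modules: the ideal `K` is a summand of `D_1`, and finite projectivity of `K`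
passes to every `D_n`. -/
lemma coexponentiable_iff (T : Tangentoid D) : T.Coexponentiable ↔
    Module.Finite R (augIdeal T.P) ∧ Module.Projective R (augIdeal T.P) := by
  constructor
  · intro h
    obtain ⟨_, _⟩ := (isRightAdjoint_tensorLeft_iff _).1 (h 1)
    exact finite_projective_augIdeal_of_pow T.P
  · rintro ⟨_, _⟩ n
    exact (isRightAdjoint_tensorLeft_iff _).2 (finite_projective_pow T.P n)

end CommAlgCat

/-! ### Solid algebras from comultiplications, and the easy half of the criterion. -/

namespace CommSolidAlg

variable {R : Type u} [CommRing R]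

lemma coexponentiable_of_isomorphic (M : CommSolidAlg R) [hf : Module.Finite R M] [hp :
    Module.Projective R M]
    {D : CommAlgCat.{u} R} {T : Tangentoid D} {T' : Tangentoid M.semidirect} (h : T.Isomorphic T') :
    T.Coexponentiable := by
  obtain ⟨e, -⟩ := h
  have : Module.Finite R M.semidirect := inferInstanceAs (Module.Finite R (R × M))
  have : Module.Projective R M.semidirect := inferInstanceAs (Module.Projective R (R × M))
  have : Module.Finite R D := Module.Finite.equiv (CommAlgCat.algEquivOfIso e).symm.toLinearEquiv
  have : Module.Projective R D := Module.Projective.of_equiv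
      (CommAlgCat.algEquivOfIso e).symm.toLinearEquiv
  exact (CommAlgCat.coexponentiable_iff T).2 (CommAlgCat.finite_projective_augIdeal T.P)

/-- A cocommutative coassociative isomorphism `K → K ⊗ K` is the inverse of the multiplication of a
commutative solid algebra. -/
def ofComul {K : Type u} [AddCommGroup K] [Module R K] (e : K ≃ₗ[R] K ⊗[R] K)
    (comm : ∀ x, TensorProduct.comm R K K (e x) = e x)
    (assoc : ∀ x, TensorProduct.assoc R K K K (e.toLinearMap.rTensor K (e x)) =
      e.toLinearMap.lTensor K (e x)) : CommSolidAlg R :=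
  letI : NonUnitalCommRing K :=
    { (inferInstance : AddCommGroup K) with
      mul x y := e.symm (x ⊗ₜ y)
      left_distrib x y z := by
        change e.symm _ = e.symm _ + e.symm _
        rw [TensorProduct.tmul_add, map_add]
      right_distrib x y z := by
        change e.symm _ = e.symm _ + e.symm _
        rw [TensorProduct.add_tmul, map_add]
      zero_mul x := by
        change e.symm _ = 0
        rw [TensorProduct.zero_tmul, map_zero]
      mul_zero x := by
        change e.symm _ = 0
        rw [TensorProduct.tmul_zero, map_zero]
      mul_comm x y := by
        change e.symm _ = e.symm _
        rw [e.symm_apply_eq, ← comm, LinearEquiv.apply_symm_apply, TensorProduct.comm_tmul]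
      mul_assoc x y z := by
        change e.symm (e.symm _ ⊗ₜ z) = e.symm (x ⊗ₜ e.symm _)
        have h := assoc (e.symm (e.symm (x ⊗ₜ y) ⊗ₜ z))
        rw [e.apply_symm_apply, LinearMap.rTensor_tmul, LinearEquiv.coe_coe, e.apply_symm_apply,
          TensorProduct.assoc_tmul] at h
        congr 1
        refine (e.lTensor K).injective (h.symm.trans ?_)
        simp }
  letI : IsScalarTower R K K := ⟨fun r x y => by
    change e.symm _ = r • e.symm _
    rw [← map_smul, TensorProduct.smul_tmul']⟩
  letI : SMulCommClass R K K := ⟨fun r x y => by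
    change r • e.symm _ = e.symm _
    rw [← map_smul, TensorProduct.tmul_smul]⟩
  { carrier := K
    bijective_mul := by
      have h : LinearMap.mul' R K = e.symm.toLinearMap := TensorProduct.ext' fun x y =>
          LinearMap.mul'_apply
      rw [h]
      exact e.symm.bijective }

end CommSolidAlg

/-! ### Every tangentoid of commutative algebras comes from a solid algebra. -/

namespace CommAlgCat

variable {R : Type u} [CommRing R] {D : CommAlgCat.{u} R} (T : Tangentoid D)

lemma tangentoid_z : T.z = ofHom (Algebra.ofId R D) := unit_hom_ext _ _

/-- An Eckmann-Hilton argument: `s` respects the addition of `D_2`, where `(d, e) = (d, r) + (r, e)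
- (r, r)`, and the unit law with commutativity evaluates `s` on each term. -/
lemma tangentoid_isFiberAdd : IsFiberAdd T.P T.s := by
  have hz (w : T.P.pow 2) (h : (T.P.π 0).hom w = aug T.P ((T.P.π 0).hom w)) : T.s.hom w =
      (T.P.π 1).hom w := by
    have h₁ := congrArg (fun k : D ⟶ D => k.hom ((T.P.π 1).hom w)) T.z_s
    refine (congrArg T.s.hom (pow_two_ext T.P ?_ ?_)).trans h₁
    · refine Eq.trans ?_ (pair_π_zero_apply T.P _ _ _ _).symm
      rw [h, aug_π T.P 0 1, tangentoid_z]; rfl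
    · exact (pair_π_one_apply T.P (T.P.p ≫ T.z) (𝟙 D) _ _).symm
  have hs (w w' : T.P.pow 2) (h : (T.P.π 0).hom w' = (T.P.π 1).hom w)
      (h' : (T.P.π 1).hom w' = (T.P.π 0).hom w) : T.s.hom w = T.s.hom w' := by
    have h₁ := congrArg (fun k : T.P.pow 2 ⟶ D => k.hom w) T.s_comm
    refine h₁.symm.trans (congrArg T.s.hom (pow_two_ext T.P ?_ ?_))
    · exact (pair_π_zero_apply T.P _ _ _ _).trans h.symm
    · exact (pair_π_one_apply T.P _ _ _ _).trans h'.symm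
  intro w
  obtain ⟨d, hd⟩ : ∃ d, (T.P.π 0).hom w = d := ⟨_, rfl⟩
  obtain ⟨e, he⟩ : ∃ e, (T.P.π 1).hom w = e := ⟨_, rfl⟩
  have hde : aug T.P e = aug T.P d := by rw [← hd, ← he, aug_π T.P 1 0]
  have haug (x : D) : aug T.P (aug T.P x) = aug T.P x := by
    rw [aug_apply _ (aug _ _), counit_aug, ← aug_apply]
  have hex (x y : D) (h : aug T.P x = aug T.P y) :
      ∃ w : T.P.pow 2, (T.P.π 0).hom w = x ∧ (T.P.π 1).hom w = y := by
    refine exists_pow_two T.P x y ?_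
    have := congrArg (counit T.P) h
    simp only [counit_aug] at this
    exact this
  obtain ⟨w₁, h₁, h₁'⟩ := hex d (aug T.P d) (haug d).symm
  obtain ⟨w₁', h₂, h₂'⟩ := hex (aug T.P d) d (haug d)
  obtain ⟨w₂, h₃, h₃'⟩ := hex (aug T.P d) e (by rw [haug, hde])
  obtain ⟨w₃, h₄, h₄'⟩ := hex (aug T.P d) (aug T.P d) rfl
  have hw : w = w₁ + w₂ - w₃ := by
    refine pow_two_ext T.P ?_ ?_
    · rw [map_sub, map_add, h₁, h₃, h₄, hd, add_sub_cancel_right]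
    · rw [map_sub, map_add, h₁', h₃', h₄', he, add_sub_cancel_left]
  rw [hd, he]
  conv_lhs => rw [hw]
  rw [map_sub, map_add, hs w₁ w₁' (by rw [h₂, h₁']) (by rw [h₂', h₁]), hz w₁' (by rw [h₂, haug]),
      h₂',
    hz w₂ (by rw [h₃, haug]), h₃', hz w₃ (by rw [h₄, haug]), h₄']

/-- `s` is multiplicative, sends `(d, 0)` to `d` and `(0, e)` to `e`, and these two pairs have
product zero. -/
lemma tangentoid_mul_eq_zero (d e : D) (hd : counit T.P d = 0) (he : counit T.P e = 0) :
    d * e = 0 := by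
  obtain ⟨w, hw₀, hw₁⟩ := exists_pow_two T.P d 0 (hd.trans (map_zero (counit T.P)).symm)
  obtain ⟨w', hw₀', hw₁'⟩ := exists_pow_two T.P 0 e ((map_zero (counit T.P)).trans he.symm)
  have hww : w * w' = 0 := pow_two_ext T.P (by rw [map_mul, hw₀', mul_zero, map_zero])
    (by rw [map_mul, hw₁, zero_mul, map_zero])
  have h₁ : T.s.hom w = d := by
    rw [tangentoid_isFiberAdd T w, hw₀, hw₁, aug_apply, hd, map_zero, add_zero, sub_zero]
  have h₂ : T.s.hom w' = e := by
    rw [tangentoid_isFiberAdd T w', hw₀', hw₁', map_zero, sub_zero, zero_add]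
  rw [← h₁, ← h₂, ← map_mul, hww, map_zero]

/-- `z_c` gives `1 ⊗ d ↦ d ⊗ 1`, involutivity gives the reverse, and these elements generate `D ⊗
D`. -/
lemma tangentoid_c_tmul (d e : D) : T.c.hom (d ⊗ₜ[R] e) = e ⊗ₜ[R] d := by
  have h₁ (d : D) : T.c.hom ((1 : D) ⊗ₜ[R] d) = d ⊗ₜ[R] (1 : D) := by
    have h := congrArg (fun k : D ⟶ D ⊗ D => k.hom d) T.z_c
    rw [tangentoid_z] at h
    have h₃ : T.c.hom (algebraMap R D 1 ⊗ₜ[R] d) = d ⊗ₜ[R] algebraMap R D 1 := h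
    rwa [map_one] at h₃
  have h₂ (d : D) : T.c.hom (d ⊗ₜ[R] (1 : D)) = (1 : D) ⊗ₜ[R] d := by
    rw [← h₁]
    exact congrArg (fun k : D ⊗ D ⟶ D ⊗ D => k.hom ((1 : D) ⊗ₜ[R] d)) T.c_c
  have h₃ : d ⊗ₜ[R] e = (d ⊗ₜ[R] (1 : D)) * ((1 : D) ⊗ₜ[R] e) := by simp
  rw [h₃]
  refine (map_mul T.c.hom _ _).trans ?_
  rw [h₁, h₂]
  exact (Algebra.TensorProduct.tmul_mul_tmul _ _ _ _).trans (by simp)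

lemma tangentoid_map_aug (d : D) :
    Algebra.TensorProduct.map (.id R D) (aug T.P) (T.l.hom d) = T.l.hom (aug T.P d) :=
  lift_map_aug T.P T.l (by rw [T.l_p, tangentoid_z]) d

lemma tangentoid_comm (d : D) : TensorProduct.comm R D D (T.l.hom d) = T.l.hom d := by
  have h := congrArg (fun k : D ⟶ D ⊗ D => k.hom d) T.l_c
  refine Eq.trans ?_ h
  change _ = T.c.hom (T.l.hom d)
  generalize T.l.hom d = y
  change D ⊗[R] D at y
  induction y with
  | zero => simp
  | add y z hy hz => rw [map_add, hy, hz]; exact (map_add T.c.hom y z).symm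
  | tmul d e => exact (tangentoid_c_tmul T d e).symm

/-- The restriction of `l` to a linear map `K → K ⊗ K` on the augmentation ideal. -/
def augComul : augIdeal T.P →ₗ[R] augIdeal T.P ⊗[R] augIdeal T.P :=
  TensorProduct.map (augProj T.P) (augProj T.P) ∘ₗ T.l.hom.toLinearMap ∘ₗ (augIdeal T.P).subtype

/-- This says that `l` maps `K` into `K ⊗ K`: the augmentation of the second factor kills `l k` by
`l_p`, that of the first by the symmetry of `l k`, so `(1 - aug) ⊗ (1 - aug)` fixes it. -/
lemma map_subtype_augComul (k : augIdeal T.P) :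
    TensorProduct.map (augIdeal T.P).subtype (augIdeal T.P).subtype (augComul T k) = T.l.hom k := by
  have h₁ : (aug T.P).toLinearMap.lTensor D (T.l.hom k) = 0 :=
    (tangentoid_map_aug T k).trans (by rw [aug_coe, map_zero])
  have h₂ : (aug T.P).toLinearMap.rTensor D (T.l.hom k) = 0 := by
    rw [← tangentoid_comm, ← LinearMap.comm_comp_lTensor_comp_comm_eq]
    simp only [LinearMap.comp_apply, LinearEquiv.coe_coe]
    rw [tangentoid_comm, tangentoid_comm, h₁, map_zero]
  have h (y : D ⊗[R] D) : TensorProduct.map (augIdeal T.P).subtype (augIdeal T.P).subtype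
      (TensorProduct.map (augProj T.P) (augProj T.P) y) = y - (aug T.P).toLinearMap.lTensor D y -
        (aug T.P).toLinearMap.rTensor D y + (aug T.P).toLinearMap.rTensor D
            ((aug T.P).toLinearMap.lTensor D y) := by
    induction y with
    | zero => simp
    | add y z hy hz => simp only [map_add, hy, hz]; abel
    | tmul d e =>
      simp [TensorProduct.tmul_sub, TensorProduct.sub_tmul]
      abel
  refine (h (T.l.hom k)).trans ?_
  rw [h₁, h₂, map_zero, sub_zero, sub_zero, add_zero]

lemma universal_apply (h) (w : T.P.pow 2) :
    (T.P.tensorPair (T.P.π 0 ≫ T.l) (T.P.π 1 ≫ (λ_ D).inv ≫ T.z ▷ D) h ≫ D ◁ T.s).hom w =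
      T.l.hom ((T.P.π 0).hom w) + (1 : D) ⊗ₜ[R] (T.P.π 1).hom w -
        algebraMap R (D ⊗[R] D) (counit T.P ((T.P.π 0).hom w)) := by
  rw [(tangentoid_isFiberAdd T).tensorPair_apply]
  refine congrArg₂ (· - ·) (congrArg₂ (· + ·) rfl ?_) ?_
  · change T.z.hom (1 : R) ⊗ₜ[R] (T.P.π 1).hom w = _
    rw [show T.z.hom (1 : R) = 1 from map_one T.z.hom]
  · exact (tangentoid_map_aug T _).trans (T.l.hom.commutes _)

/-- The universality of the lift, restricted to the fibre over `0`. -/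
lemma augComul_bijective : Function.Bijective (augComul T) := by
  obtain ⟨-, hinj, hsurj⟩ := (isPullback_iff _ _ _ _).1 T.universal
  constructor
  · refine (injective_iff_map_eq_zero _).2 ?_
    intro k hk
    have hl : T.l.hom k = 0 := by rw [← map_subtype_augComul, hk, map_zero]
    have hck : counit T.P k = 0 := k.2
    obtain ⟨w, hw₀, hw₁⟩ := exists_pow_two T.P (k : D) 0 (hck.trans (map_zero (counit T.P)).symm)
    have hw : w = 0 := by
      refine hinj w 0 ?_ ?_
      · rw [universal_apply, hw₀, hw₁, hl, hck, map_zero, TensorProduct.tmul_zero, map_zero,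
          add_zero, sub_zero]
      · exact (congrArg (counit T.P) hw₀).trans (hck.trans (map_zero _).symm)
    refine Subtype.ext ?_
    rw [← hw₀, hw, map_zero]
    rfl
  · intro t
    let y := TensorProduct.map (augIdeal T.P).subtype (augIdeal T.P).subtype t
    have hy : (D ◁ T.P.p ≫ (ρ_ D).hom).hom y = T.z.hom (0 : R) := by
      refine Eq.trans ?_ (map_zero T.z.hom).symm
      change (D ◁ T.P.p ≫ (ρ_ D).hom).hom (TensorProduct.map _ _ t) = 0
      induction t with
      | zero => exact map_zero _
      | add t t' h h' =>
        rw [map_add]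
        exact (map_add (D ◁ T.P.p ≫ (ρ_ D).hom).hom _ _).trans (by rw [h, h', add_zero])
      | tmul a b =>
        change counit T.P b • (a : D) = 0
        rw [show counit T.P b = 0 from b.2, zero_smul]
    obtain ⟨w, hw, hw'⟩ := hsurj y _ hy
    have hc : counit T.P ((T.P.π 0).hom w) = 0 := hw'
    refine ⟨⟨(T.P.π 0).hom w, hc⟩, ?_⟩
    rw [universal_apply, hc, map_zero, sub_zero] at hw
    -- Projecting to `K ⊗ K` discards the term `1 ⊗ e`, leaving only the image of the first
    -- component.
    have := congrArg (TensorProduct.map (augProj T.P) (augProj T.P)) hw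
    rw [map_add, TensorProduct.map_tmul, augProj_one, TensorProduct.zero_tmul, add_zero] at this
    refine this.trans ?_
    change TensorProduct.map _ _ (TensorProduct.map _ _ t) = t
    rw [← LinearMap.comp_apply, ← TensorProduct.map_comp, augProj_comp_subtype,
        TensorProduct.map_id,
      LinearMap.id_apply]

/-- `l` as an isomorphism `K ≃ K ⊗ K` on the augmentation ideal. -/
def augComulEquiv : augIdeal T.P ≃ₗ[R] augIdeal T.P ⊗[R] augIdeal T.P :=
  LinearEquiv.ofBijective (augComul T) (augComul_bijective T)

lemma augComul_comm (k : augIdeal T.P) :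
    TensorProduct.comm R _ _ (augComul T k) = augComul T k := by
  conv_rhs => rw [augComul, LinearMap.comp_apply, LinearMap.comp_apply, AlgHom.toLinearMap_apply,
    Submodule.subtype_apply, ← tangentoid_comm]
  exact (TensorProduct.map_comm _ _ _).symm

/-- Coassociativity of `l` on `D`, projected to `K ⊗ K ⊗ K`. -/
lemma augComul_assoc (k : augIdeal T.P) :
    TensorProduct.assoc R _ _ _ ((augComul T).rTensor (augIdeal T.P) (augComul T k)) =
      (augComul T).lTensor (augIdeal T.P) (augComul T k) := by
  have h : T.l.hom.toLinearMap.lTensor D (T.l.hom k) =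
      TensorProduct.assoc R D D D (T.l.hom.toLinearMap.rTensor D (T.l.hom k)) :=
    congrArg (fun f : D ⟶ D ⊗ (D ⊗ D) => f.hom (k : D)) T.l_l
  rw [← map_subtype_augComul] at h
  have h' := congrArg (TensorProduct.map (augProj T.P)
    (TensorProduct.map (augProj T.P) (augProj T.P))) h
  have h₁ (t : augIdeal T.P ⊗[R] augIdeal T.P) :
      TensorProduct.map (augProj T.P) (TensorProduct.map (augProj T.P) (augProj T.P))
        (T.l.hom.toLinearMap.lTensor D
          (TensorProduct.map (augIdeal T.P).subtype (augIdeal T.P).subtype t)) =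
      (augComul T).lTensor (augIdeal T.P) t := by
    induction t with
    | zero => simp
    | add t t' h h' => simp only [map_add, h, h']
    | tmul a b =>
      change augProj T.P a ⊗ₜ[R] _ = a ⊗ₜ[R] _
      rw [augProj_coe]; rfl
  have h₂ (t : augIdeal T.P ⊗[R] augIdeal T.P) :
      TensorProduct.map (augProj T.P) (TensorProduct.map (augProj T.P) (augProj T.P))
        (TensorProduct.assoc R D D D (T.l.hom.toLinearMap.rTensor D
          (TensorProduct.map (augIdeal T.P).subtype (augIdeal T.P).subtype t))) =
      TensorProduct.assoc R _ _ _ ((augComul T).rTensor (augIdeal T.P) t) := by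
    induction t with
    | zero => simp
    | add t t' h h' => simp only [map_add, h, h']
    | tmul a b =>
      rw [TensorProduct.map_map_assoc]
      refine congrArg _ ?_
      change _ ⊗ₜ[R] augProj T.P b = _ ⊗ₜ[R] b
      rw [augProj_coe]; rfl
  rw [h₁, h₂] at h'
  exact h'.symm

/-- The solid algebra attached to a tangentoid: the augmentation ideal, with the inverse of `l` as
multiplication. -/
def solidAlg : CommSolidAlg R :=
  CommSolidAlg.ofComul (augComulEquiv T) (augComul_comm T) (augComul_assoc T)

/-- The elements of the solid algebra attached to a tangentoid as elements of the tangentoid. -/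
def solidIncl : solidAlg T →ₗ[R] D := (augIdeal T.P).subtype

lemma counit_solidIncl (m : solidAlg T) : counit T.P (solidIncl T m) = 0 :=
  (m : augIdeal T.P).2

/-- The projection onto the solid algebra attached to a tangentoid. -/
def solidProj : D →ₗ[R] solidAlg T := augProj T.P

lemma solidProj_incl (m : solidAlg T) : solidProj T (solidIncl T m) = m := augProj_coe T.P m

lemma solidIncl_proj (d : D) : solidIncl T (solidProj T d) = d - aug T.P d := rfl

lemma l_solidIncl_mul (x y : solidAlg T) :
    T.l.hom (solidIncl T (x * y)) = solidIncl T x ⊗ₜ[R] solidIncl T y := by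
  refine (map_subtype_augComul T (x * y : solidAlg T)).symm.trans ?_
  have h : augComul T (x * y : solidAlg T) = (x : augIdeal T.P) ⊗ₜ[R] (y : augIdeal T.P) :=
    (augComulEquiv T).apply_symm_apply _
  rw [h]
  rfl

/-- The identification of `R ⋉ K` with `D`. -/
def solidHom : TrivSqZeroExt R (solidAlg T) →ₐ[R] D :=
  TrivSqZeroExt.liftEquivOfComm ⟨solidIncl T, fun x y =>
    tangentoid_mul_eq_zero T _ _ (counit_solidIncl T x) (counit_solidIncl T y)⟩

lemma solidHom_inr (m : solidAlg T) : solidHom T (TrivSqZeroExt.inr m) = solidIncl T m :=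
  DFunLike.congr_fun (congrArg Subtype.val (TrivSqZeroExt.liftEquivOfComm.symm_apply_apply
    (⟨solidIncl T, fun x y => tangentoid_mul_eq_zero T _ _ (counit_solidIncl T x)
      (counit_solidIncl T y)⟩ : { f : solidAlg T →ₗ[R] D // ∀ x y, f x * f y = 0 }))) m

lemma solidHom_inl (r : R) : solidHom T (TrivSqZeroExt.inl r) = algebraMap R D r :=
  (solidHom T).commutes r

lemma solidHom_apply (d : TrivSqZeroExt R (solidAlg T)) :
    solidHom T d = algebraMap R D d.fst + solidIncl T d.snd := by
  conv_lhs => rw [← TrivSqZeroExt.inl_fst_add_inr_snd_eq d]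
  rw [map_add, solidHom_inl, solidHom_inr]

lemma counit_solidHom (d : TrivSqZeroExt R (solidAlg T)) : counit T.P (solidHom T d) = d.fst := by
  rw [solidHom_apply, map_add, counit_solidIncl, add_zero, AlgHom.commutes]
  rfl

/-- The identification of `D` with `R ⋉ K`. -/
def solidEquiv : TrivSqZeroExt R (solidAlg T) ≃ₐ[R] D :=
  AlgEquiv.ofBijective (solidHom T) (by
    constructor
    · intro d e h
      have h₁ : d.fst = e.fst := by rw [← counit_solidHom, h, counit_solidHom]
      refine TrivSqZeroExt.ext h₁ ?_
      rw [solidHom_apply, solidHom_apply, h₁, add_right_inj] at h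
      rw [← solidProj_incl T d.snd, h, solidProj_incl]
    · intro d
      refine ⟨TrivSqZeroExt.inl (counit T.P d) + TrivSqZeroExt.inr (solidProj T d), ?_⟩
      rw [map_add, solidHom_inl, solidHom_inr, solidIncl_proj, aug_apply, add_sub_cancel])

/-- The isomorphism between a tangentoid and `R ⋉ K`. -/
def solidIso : D ≅ (solidAlg T).semidirect :=
  isoMk (solidEquiv T).symm

/-- Every tangentoid of commutative algebras comes from a solid algebra. -/
lemma isHom_solidIso :
    T.IsHom (solidAlg T).tangentoid (solidIso T).hom := by
  have hφ (d : D) : solidHom T ((solidEquiv T).symm d) = d := (solidEquiv T).apply_symm_apply d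
  have hψ (d : TrivSqZeroExt R (solidAlg T)) : (solidEquiv T).symm (solidHom T d) = d :=
    (solidEquiv T).symm_apply_apply d
  have hfst (d : D) : ((solidEquiv T).symm d).fst = counit T.P d := by
    rw [← counit_solidHom, hφ]
  have hp : (solidIso T).hom ≫ (solidAlg T).tangentoid.P.p = T.P.p := hom_ext (AlgHom.ext hfst)
  refine ⟨hp, unit_hom_ext _ _, ?_, ?_, ?_⟩
  · refine hom_ext (AlgHom.ext fun w => ?_)
    let f : D →ₐ[R] (solidAlg T).semidirect := (solidIso T).hom.hom
    refine (tangentoid_isFiberAdd (solidAlg T).tangentoid _).trans ?_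
    change _ = f (T.s.hom w)
    rw [tangentoid_isFiberAdd T w, map_sub, map_add]
    have h₀ := pair_π_zero_apply (solidAlg T).tangentoid.P (T.P.π 0 ≫ (solidIso T).hom)
      (T.P.π 1 ≫ (solidIso T).hom) (by
        simp only [Category.assoc, hp]; exact T.P.π_p 0 1) w
    have h₁ := pair_π_one_apply (solidAlg T).tangentoid.P (T.P.π 0 ≫ (solidIso T).hom)
      (T.P.π 1 ≫ (solidIso T).hom) (by
        simp only [Category.assoc, hp]; exact T.P.π_p 0 1) w
    refine congrArg₂ (· - ·) (congrArg₂ (· + ·) h₀ h₁) ?_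
    refine (congrArg (aug _) h₀).trans ?_
    rw [aug_apply T.P, AlgHom.commutes]
    exact congrArg (algebraMap R _) (hfst _)
  -- After precomposition with the inverse the source is `R ⋉ K`, where testing on products of `K`
  -- is enough.
  · refine (cancel_epi (solidIso T).inv).1 ?_
    rw [Iso.inv_hom_id_assoc]
    refine (solidAlg T).semidirect_hom_ext fun x y => ?_
    refine ((solidAlg T).liftHom_inr_mul x y).trans ?_
    change _ = Algebra.TensorProduct.map (solidIso T).hom.hom (solidIso T).hom.hom
      (T.l.hom (solidHom T (TrivSqZeroExt.inr (x * y))))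
    rw [solidHom_inr, l_solidIncl_mul, ← solidHom_inr, ← solidHom_inr]
    exact congrArg₂ (· ⊗ₜ[R] ·) (hψ (TrivSqZeroExt.inr x)).symm (hψ (TrivSqZeroExt.inr y)).symm
  · refine hom_ext (Algebra.TensorProduct.ext' fun d e => ?_)
    change _ = (Algebra.TensorProduct.map _ _) (T.c.hom (d ⊗ₜ[R] e))
    rw [tangentoid_c_tmul]
    rfl

end CommAlgCat

end

theorem mainTheorem2 (R : Type u) [CommRing R] :
    (∀ M : CommSolidAlg R, Module.Finite R M → Module.Projective R M →
      ∃! T : Tangentoid M.semidirect, M.IsAssociated T) ∧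
    (∀ (D : CommAlgCat.{u} R) (T : Tangentoid D),
      T.Coexponentiable ↔
        ∃ M : CommSolidAlg R, Module.Finite R M ∧ Module.Projective R M ∧
          ∃ T' : Tangentoid M.semidirect, M.IsAssociated T' ∧ T.Isomorphic T') := by
  refine ⟨fun M _ _ => ⟨M.tangentoid, M.isAssociated_tangentoid, fun T hT =>
    hT.ext M M.isAssociated_tangentoid⟩, fun D T => ⟨fun h => ?_, ?_⟩⟩
  · obtain ⟨hf, hp⟩ := (CommAlgCat.coexponentiable_iff T).1 h
    exact ⟨CommAlgCat.solidAlg T, hf, hp, _, CommSolidAlg.isAssociated_tangentoid _,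
      CommAlgCat.solidIso T, CommAlgCat.isHom_solidIso T⟩
  · rintro ⟨M, _, _, T', -, h⟩
    exact M.coexponentiable_of_isomorphic h
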